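/- Let $\varphi:\{0,1,2,\dots\}\to\mathbb{R}$ be a function that is not linear, i.e. not of the form $\varphi(x)=a+bx$ with $a,b\in\mathbb{R}$, and suppose that there is a constant $K>0$ such that $|\varphi(x)|\le K e^{Kx}$ for all integers $x\ge 0$. For each $n\ge 1$ let $m=m_n$ be a non-negative integer, and suppose that $\lim_{n\to\infty} n/m_n$ exists and lies in $(0,\infty)$. Let $m_n$ balls be distributed independently among $n$ urns, each ball being placed in urn $i$ with probability $p_i=1/n$, $1\le i\le n$; let $\xi_i$ be the number of balls in urn $i$, and put $$V=\sum_{i=1}^n\varphi(\xi_i),\qquad \mu_i=\mathbb{E}\varphi(\xi_i),\qquad \sigma^2=\operatorname{Var} V,\qquad W=\frac1\sigma\sum_{i=1}^n\bigl(\varphi(\xi_i)-\mu_i\bigr).$$ Then, as $n\to\infty$, $\sigma^2\asymp n$ (that is, there are constants $0<c_1\le c_2<\infty$ with $c_1 n\le\sigma^2\le c_2 n$ for all sufficiently large $n$), and $$d_{\mathrm{K}}\bigl(\mathscr{L}(W),\mathcal{N}(0,1)\bigr)=\sup_{x\in\mathbb{R}}\bigl|\mathbb{P}[W\le x]-\mathbb{P}[Z\le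 x]\bigr|=\mathrm{O}\bigl(n^{-1/2}\bigr),$$ where $Z\sim\mathcal{N}(0,1)$. -/

import Mathlib

open Filter MeasureTheory ProbabilityTheory Asymptotics

noncomputable section

/-- Kolmogorov distance `sup_x |μ(-∞,x] - ν(-∞,x]|` between two laws on the real line. -/
def kolmogorovDist (μ ν : Measure ℝ) : ℝ :=
  ⨆ x : ℝ, |μ.real (Set.Iic x) - ν.real (Set.Iic x)|

namespace Occupancy

/-- The law of the urn chosen by one ball: urn `i` is chosen with probability `p i`. -/
def ballLaw {n : ℕ} (p : Fin n → ℝ) : Measure (Fin n) :=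
  ∑ i, ENNReal.ofReal (p i) • Measure.dirac i

/-- The law of the allocation `ω : Fin m → Fin n` (`ω j` is the urn that receives ball `j`) of
`m` balls which are independently distributed among `n` urns. -/
def urnLaw {n : ℕ} (m : ℕ) (p : Fin n → ℝ) : Measure (Fin m → Fin n) :=
  Measure.pi fun _ => ballLaw p

/-- The number of balls in urn `i`. -/
def count {m n : ℕ} (i : Fin n) (ω : Fin m → Fin n) : ℕ :=
  (Finset.univ.filter fun j => ω j = i).card

/-- The additive functional `V = ∑ i, φ i (ξ i)` of the ball counts. -/
def V {n : ℕ} (m : ℕ) (φ : Fin n → ℕ → ℝ) (ω : Fin m → Fin n) : ℝ :=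
  ∑ i, φ i (count i ω)

/-- The mean `E (φ i (ξ i))`. -/
def mean {n : ℕ} (m : ℕ) (p : Fin n → ℝ) (φ : Fin n → ℕ → ℝ) (i : Fin n) : ℝ :=
  ∫ ω, φ i (count i ω) ∂(urnLaw m p)

/-- The variance `σ²` of `V`. -/
def sigmaSq {n : ℕ} (m : ℕ) (p : Fin n → ℝ) (φ : Fin n → ℕ → ℝ) : ℝ :=
  variance (V m φ) (urnLaw m p)

/-- The centered and normalized statistic `W = σ⁻¹ ∑ i, (φ i (ξ i) - E (φ i (ξ i)))`. -/
def W {n : ℕ} (m : ℕ) (p : Fin n → ℝ) (φ : Fin n → ℕ → ℝ) (ω : Fin m → Fin n) : ℝ :=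
  1 / Real.sqrt (sigmaSq m p φ) * ∑ i, (φ i (count i ω) - mean m p φ i)

end Occupancy

end

/-! The urn counts have the law of `n` independent Poisson(`r`) variables, `r = m / n`, conditioned
to have sum `m`. Integrating `e^{iu(Σξ - m)}` over `u ∈ [-π, π]` carries out the conditioning. Hence
the expectation of a product over urns is an integral over `u` of a product of one-urn Fourier
integrals, divided by `2π P[Po(m) = m]`, which is at least of order `n^{-1/2}`
(`integral_prod_poisson`, `le_exp_neg_mul_pow_div_factorial`).

Since `Σ ξ_i` is fixed, the linear part of `φ` contributes only a constant, so `φ` may be replaced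
by its residual `Y` after regression on the Poisson variable. Nonlinearity keeps the variance `s` of
`Y` away from zero, and exponential growth bounds its third moment, both uniformly for `r` in a
compact subset of `(0, ∞)` (`exists_poisson_residual`). Because `Y` is centered and uncorrelated
with `k - r`, the joint characteristic function has no `tu` term: it is `1 - t²s/2` times that of `k
- r`, up to `O(|t|(t² + u²))`. Taking `n`-th powers and integrating over `u`, which is effectively
of size `n^{-1/2}`, gives for `U = Σ Y(ξ_i)` and small `t` the approximation `E e^{itU} =
e^{-nst²/2} + O(|t|(1 + nt²)e^{-cnt²})` (`exists_norm_charFun_sub_le`).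

The same integrals with one or two nontrivial factors give `E U = O(1)` and `E U² = ns + O(√n)`,
hence `σ² ≍ n`. After division by `σ`, the error in the characteristic function is
`O(n^{-1/2}|t|e^{-c't²})` for `|t|` up to a multiple of `√n`. The factor `|t|` cancels the `1/t` in
Esseen's smoothing inequality (`esseen_smoothing`), which then yields the rate. -/

/-! ### Fejér smoothing and Esseen's inequality -/

/-- The Fejér kernel `(1 - cos y) / y ^ 2`, written as a Fourier integral. -/
noncomputable def fejer (y : ℝ) : ℝ := ∫ t in (0 : ℝ)..1, (1 - t) * Real.cos (t * y)

lemma continuous_fejer : Continuous fejer := by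
  unfold fejer
  apply intervalIntegral.continuous_parametric_intervalIntegral_of_continuous'
  fun_prop

/-- Two integrations by parts. This closed form gives both the positivity of the kernel and its
quadratic decay, hence integrability. -/
lemma fejer_mul_sq (y : ℝ) : fejer y * y ^ 2 = 1 - Real.cos y := by
  have h : ∀ t ∈ Set.uIcc (0 : ℝ) 1, HasDerivAt
      (fun t => (1 - t) * Real.sin (t * y) * y - Real.cos (t * y))
      ((1 - t) * Real.cos (t * y) * y ^ 2) t := by
    intro t _
    have h1 : HasDerivAt (fun t : ℝ => t * y) y t := by
      simpa using (hasDerivAt_id t).mul_const y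
    have h2 := ((((hasDerivAt_id t).const_sub 1).mul h1.sin).mul_const y).sub h1.cos
    convert! h2 using 1
    simp
    ring
  have := intervalIntegral.integral_eq_sub_of_hasDerivAt h
    (Continuous.intervalIntegrable (by fun_prop) _ _)
  rw [intervalIntegral.integral_mul_const] at this
  rw [fejer, this]
  simp
  ring

lemma fejer_zero : fejer 0 = 1 / 2 := by
  simp only [fejer, mul_zero, Real.cos_zero, mul_one]
  rw [intervalIntegral.integral_sub (by simp) (by simp)]
  simp
  norm_num

lemma fejer_nonneg (y : ℝ) : 0 ≤ fejer y := by
  rcases eq_or_ne y 0 with rfl | hy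
  · rw [fejer_zero]; norm_num
  · have h := fejer_mul_sq y
    have : 0 < y ^ 2 := by positivity
    have h2 := Real.cos_le_one y
    by_contra! hc
    nlinarith

lemma fejer_le_one (y : ℝ) : fejer y ≤ 1 := by
  have : ‖fejer y‖ ≤ 1 * |(1 : ℝ) - 0| := by
    apply intervalIntegral.norm_integral_le_of_norm_le_const
    intro t ht
    rw [Set.uIoc_of_le zero_le_one] at ht
    rw [norm_mul]
    have h1 : ‖1 - t‖ ≤ 1 := by
      rw [Real.norm_eq_abs, abs_le]; constructor <;> linarith [ht.1, ht.2]
    have h2 : ‖Real.cos (t * y)‖ ≤ 1 := Real.abs_cos_le_one _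
    exact mul_le_one₀ h1 (norm_nonneg _) h2
  simp at this
  exact (le_abs_self _).trans this

lemma integrable_fejer : Integrable fejer := by
  refine Integrable.mono' (integrable_inv_one_add_sq.const_mul 4)
    continuous_fejer.aestronglyMeasurable (ae_of_all _ fun y => ?_)
  rw [Real.norm_eq_abs, abs_of_nonneg (fejer_nonneg y), ← div_eq_mul_inv,
    le_div_iff₀ (by positivity)]
  have h1 := fejer_mul_sq y
  have h2 := Real.neg_one_le_cos y
  have h3 := fejer_le_one y
  linarith

lemma integral_fejer_pos : 0 < ∫ y, fejer y := by
  have h0 : (0 : ℝ) < fejer 0 := by rw [fejer_zero]; norm_num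
  exact integral_pos_of_integrable_nonneg_nonzero (x := 0) continuous_fejer integrable_fejer
    (fun y => fejer_nonneg y) h0.ne'

/-- The probability law whose density is proportional to the Fejér kernel. -/
noncomputable def fejerLaw : Measure ℝ :=
  volume.withDensity fun y => ENNReal.ofReal (fejer y / ∫ z, fejer z)

lemma fejerLaw_real {s : Set ℝ} (hs : MeasurableSet s) :
    fejerLaw.real s = (∫ y in s, fejer y) / ∫ z, fejer z := by
  rw [measureReal_def, fejerLaw, withDensity_apply _ hs, ← integral_div,
    integral_eq_lintegral_of_nonneg_ae (μ := volume.restrict s)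
      (f := fun y => fejer y / ∫ z, fejer z)
      (ae_of_all _ fun y => div_nonneg (fejer_nonneg y) integral_fejer_pos.le)
      (continuous_fejer.div_const _).aestronglyMeasurable]

instance : IsProbabilityMeasure fejerLaw := by
  constructor
  rw [fejerLaw, withDensity_apply _ MeasurableSet.univ, setLIntegral_univ,
    ← ofReal_integral_eq_lintegral_ofReal (integrable_fejer.div_const _)
      (ae_of_all _ fun y => div_nonneg (fejer_nonneg y) integral_fejer_pos.le),
    integral_div, div_self integral_fejer_pos.ne', ENNReal.ofReal_one]

lemma fejerLaw_real_Iic (z : ℝ) : fejerLaw.real (Set.Iic z) =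
    fejerLaw.real (Set.Iic 0) + (∫ y in (0 : ℝ)..z, fejer y) / ∫ y, fejer y := by
  rw [fejerLaw_real measurableSet_Iic, fejerLaw_real measurableSet_Iic, ← add_div,
    ← intervalIntegral.integral_Iic_sub_Iic integrable_fejer.integrableOn
      integrable_fejer.integrableOn]
  congr 1
  ring

/-- Any mass above `1/2` would serve: the part of the smoothing law near zero must outweigh the rest
when the supremum of the difference is absorbed. -/
lemma exists_fejerLaw_Icc : ∃ h : ℝ, 0 < h ∧ 3 / 4 ≤ fejerLaw.real (Set.Icc (-h) h) := by
  have hmono : Monotone fun n : ℕ => Set.Icc (-(n : ℝ)) n := by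
    intro a b hab
    have : (a : ℝ) ≤ b := by exact_mod_cast hab
    exact Set.Icc_subset_Icc (by linarith) this
  have hU : ⋃ n : ℕ, Set.Icc (-(n : ℝ)) n = Set.univ := by
    refine Set.eq_univ_of_forall fun x => ?_
    obtain ⟨n, hn⟩ := exists_nat_ge |x|
    exact Set.mem_iUnion.2 ⟨n, abs_le.1 hn⟩
  have h := tendsto_measure_iUnion_atTop (μ := fejerLaw) hmono
  rw [hU, measure_univ] at h
  have h2 := (ENNReal.tendsto_toReal ENNReal.one_ne_top).comp h
  have h3 := h2.eventually (lt_mem_nhds (show (3 / 4 : ℝ) < ENNReal.toReal 1 by norm_num))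
  obtain ⟨n, hn, hn1⟩ := (h3.and (eventually_ge_atTop 1)).exists
  exact ⟨n, by exact_mod_cast hn1, hn.le⟩

/-- The difference of the smoothed distribution functions, computed in two ways. -/
lemma integral_cdf_sub (μ ρ : Measure ℝ) [IsProbabilityMeasure μ] [IsProbabilityMeasure ρ] (x : ℝ) :
    ∫ y, μ.real (Set.Iic (x - y)) ∂ρ = ∫ u, ρ.real (Set.Iic (x - u)) ∂μ := by
  have hs : MeasurableSet {p : ℝ × ℝ | p.1 + p.2 ≤ x} :=
    measurableSet_le (by fun_prop) (by fun_prop)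
  have h1 : ∀ y, μ.real (Set.Iic (x - y)) =
      ∫ u, {p : ℝ × ℝ | p.1 + p.2 ≤ x}.indicator (fun _ => (1 : ℝ)) (u, y) ∂μ := by
    intro y
    rw [← integral_indicator_one measurableSet_Iic]
    congr 1; ext u
    simp [Set.indicator, le_sub_iff_add_le]
  have h2 : ∀ u, ρ.real (Set.Iic (x - u)) =
      ∫ y, {p : ℝ × ℝ | p.1 + p.2 ≤ x}.indicator (fun _ => (1 : ℝ)) (u, y) ∂ρ := by
    intro u
    rw [← integral_indicator_one measurableSet_Iic]
    congr 1; ext y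
    simp [Set.indicator, le_sub_iff_add_le, add_comm]
  simp_rw [h1, h2]
  rw [integral_integral_swap (f := fun u y =>
    {p : ℝ × ℝ | p.1 + p.2 ≤ x}.indicator (fun _ => (1 : ℝ)) (u, y))]
  exact (integrable_const (1 : ℝ)).indicator hs

lemma integral_cos_mul (t z : ℝ) : t * ∫ y in (0 : ℝ)..z, Real.cos (t * y) = Real.sin (t * z) := by
  have h : ∀ y ∈ Set.uIcc (0 : ℝ) z, HasDerivAt (fun y => Real.sin (t * y))
      (t * Real.cos (t * y)) y := by
    intro y _
    have h1 : HasDerivAt (fun y : ℝ => t * y) t y := by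
      simpa using (hasDerivAt_id y).const_mul t
    convert! h1.sin using 1
    ring
  have := intervalIntegral.integral_eq_sub_of_hasDerivAt h
    (Continuous.intervalIntegrable (by fun_prop) _ _)
  rw [intervalIntegral.integral_const_mul] at this
  simp [this]

lemma continuous_integral_cos_mul (t x : ℝ) :
    Continuous fun u : ℝ => ∫ y in (0 : ℝ)..(x - u), Real.cos (t * y) := by
  have h : Continuous fun z : ℝ => ∫ y in (0 : ℝ)..z, Real.cos (t * y) :=
    intervalIntegral.continuous_primitive
      (fun a b => Continuous.intervalIntegrable (by fun_prop) _ _) 0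
  exact h.comp (by fun_prop)

lemma abs_integral_cos_mul_le (t z : ℝ) : |∫ y in (0 : ℝ)..z, Real.cos (t * y)| ≤ |z| := by
  have := intervalIntegral.norm_integral_le_of_norm_le_const (a := 0) (b := z) (C := 1)
    (f := fun y => Real.cos (t * y)) (fun y _ => Real.abs_cos_le_one _)
  simpa using this

lemma integrable_continuous_uIoc_prod {f : ℝ × ℝ → ℝ} (hf : Continuous f) (a b c d : ℝ) :
    Integrable f ((volume.restrict (Set.uIoc a b)).prod (volume.restrict (Set.uIoc c d))) := by
  rw [Measure.prod_restrict]
  refine IntegrableOn.mono_set (t := Set.uIcc a b ×ˢ Set.uIcc c d) ?_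
    (Set.prod_mono Set.uIoc_subset_uIcc Set.uIoc_subset_uIcc)
  exact hf.continuousOn.integrableOn_compact (isCompact_uIcc.prod isCompact_uIcc)

/-- Fubini. The primitive of the kernel becomes a mixture of `sin (t z) / t` over `t ∈ [0, 1]` only,
which is why smoothing sees only these frequencies. Keeping the inner cosine integral avoids the
singularity at `t = 0`. -/
lemma integral_fejer (z : ℝ) : ∫ y in (0 : ℝ)..z, fejer y =
    ∫ t in (0 : ℝ)..1, (1 - t) * ∫ y in (0 : ℝ)..z, Real.cos (t * y) := by
  simp_rw [fejer, ← intervalIntegral.integral_const_mul]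
  simp_rw [intervalIntegral.intervalIntegral_eq_integral_uIoc _ 0 z]
  rw [intervalIntegral.integral_smul]
  congr 1
  rw [intervalIntegral_integral_swap]
  exact integrable_continuous_uIoc_prod
    (f := fun p : ℝ × ℝ => (1 - p.1) * Real.cos (p.1 * p.2)) (by fun_prop) _ _ _ _

lemma measurable_real_Iic (μ : Measure ℝ) [IsFiniteMeasure μ] :
    Measurable fun x => μ.real (Set.Iic x) :=
  Monotone.measurable fun _ _ hab => measureReal_mono (Set.Iic_subset_Iic.2 hab)

lemma integrable_cdf_sub (μ ρ : Measure ℝ) [IsProbabilityMeasure μ] [IsProbabilityMeasure ρ]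
    (x : ℝ) : Integrable (fun y => μ.real (Set.Iic (x - y))) ρ := by
  refine Integrable.mono' (integrable_const 1)
    ((measurable_real_Iic μ).comp (measurable_const.sub measurable_id)).aestronglyMeasurable
    (ae_of_all _ fun y => ?_)
  rw [Real.norm_eq_abs, abs_of_nonneg measureReal_nonneg]
  exact measureReal_le_one

lemma le_integral_of_le_on {ρ : Measure ℝ} [IsProbabilityMeasure ρ] {f : ℝ → ℝ}
    (hf : Integrable f ρ) {a D : ℝ} {I : Set ℝ} (hI : MeasurableSet I) (hD : ∀ y, -D ≤ f y)
    (ha : ∀ y ∈ I, a ≤ f y) : (a + D) * ρ.real I - D ≤ ∫ y, f y ∂ρ := by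
  have h1 : Integrable (I.indicator fun _ => a + D) ρ := (integrable_const _).indicator hI
  have h2 : ∫ y, (I.indicator (fun _ => a + D) y - D) ∂ρ = (a + D) * ρ.real I - D := by
    rw [integral_sub h1 (integrable_const _), integral_indicator_const _ hI]
    simp [mul_comm]
  rw [← h2]
  refine integral_mono (h1.sub (integrable_const _)) hf fun y => ?_
  by_cases hy : y ∈ I
  · simpa [hy] using ha y hy
  · simpa [hy] using hD y

/-- If the smoothed difference of two distribution functions is at most `R`, one of them
`M`-Lipschitz, then so is the difference itself, up to constants. -/
lemma abs_cdf_sub_le_of_smoothed (μ ν ρ : Measure ℝ) [IsProbabilityMeasure μ]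
    [IsProbabilityMeasure ν] [IsProbabilityMeasure ρ] {M R h : ℝ} (hM0 : 0 ≤ M)
    (hM : ∀ x y, x ≤ y → ν.real (Set.Iic y) - ν.real (Set.Iic x) ≤ M * (y - x))
    (hh : 0 < h) (hρ : 3 / 4 ≤ ρ.real (Set.Icc (-h) h))
    (hR : ∀ x, |∫ y, (μ.real (Set.Iic (x - y)) - ν.real (Set.Iic (x - y))) ∂ρ| ≤ R) (x : ℝ) :
    |μ.real (Set.Iic x) - ν.real (Set.Iic x)| ≤ 2 * R + 4 * M * h := by
  set F : ℝ → ℝ := fun x => μ.real (Set.Iic x) with hF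
  set G : ℝ → ℝ := fun x => ν.real (Set.Iic x) with hG
  have hFm : Monotone F := fun _ _ hab => measureReal_mono (Set.Iic_subset_Iic.2 hab)
  have hF1 : ∀ x, 0 ≤ F x ∧ F x ≤ 1 := fun x => ⟨measureReal_nonneg, measureReal_le_one⟩
  have hG1 : ∀ x, 0 ≤ G x ∧ G x ≤ 1 := fun x => ⟨measureReal_nonneg, measureReal_le_one⟩
  have hbdd : BddAbove (Set.range fun x => |F x - G x|) := by
    refine ⟨1, ?_⟩
    rintro _ ⟨y, rfl⟩
    have := hF1 y
    have := hG1 y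
    exact abs_le.2 ⟨by linarith, by linarith⟩
  set D := ⨆ x, |F x - G x| with hDdef
  have hD : ∀ y, |F y - G y| ≤ D := fun y => le_ciSup hbdd y
  refine (hD x).trans (le_of_forall_pos_le_add fun ε hε => ?_)
  obtain ⟨x0, hx0⟩ := exists_lt_of_lt_ciSup (show D - ε / 2 < D by linarith)
  have hint : ∀ x, Integrable (fun y => F (x - y) - G (x - y)) ρ := fun x =>
    (integrable_cdf_sub μ ρ x).sub (integrable_cdf_sub ν ρ x)
  have hR0 : 0 ≤ R := (abs_nonneg _).trans (hR 0)
  have hq1 : ρ.real (Set.Icc (-h) h) ≤ 1 := measureReal_le_one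
  have hMh : 0 ≤ M * h := by positivity
  -- With mass `q ≥ 3/4` the left side is at least `D/2` minus Lipschitz and `ε` terms, so `D` is
  -- bounded by `R`; if the bracket is negative, `D` is already small.
  have key : ∀ I, (D - ε / 2 - 2 * M * h + D) * ρ.real (Set.Icc (-h) h) - D ≤ I → I ≤ R →
      D ≤ 2 * R + 4 * M * h + ε := by
    intro I h1 h2
    rcases le_or_gt 0 (D - ε / 2 - 2 * M * h + D) with h3 | h3
    · have := mul_le_mul_of_nonneg_left hρ h3
      linarith
    · linarith
  -- If `F - G` is nearly `D` at `x0`, monotonicity of `F` and the Lipschitz bound on `G` keep it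
  -- within `2Mh` of that on `[x0, x0 + 2h]`, so the smoothed difference is tested at `x0 + h`. If
  -- `G - F` is nearly `D`, the interval lies to the left.
  rcases lt_abs.1 hx0 with h0 | h0
  · refine key _ (le_integral_of_le_on (hint (x0 + h)) measurableSet_Icc
      (fun y => (abs_le.1 (hD _)).1) fun y hy => ?_) ((abs_le.1 (hR (x0 + h))).2)
    have h1 : F x0 ≤ F (x0 + h - y) := hFm (by linarith [hy.2])
    have h2 := hM x0 (x0 + h - y) (by linarith [hy.2])
    have h3 : M * (x0 + h - y - x0) ≤ M * (2 * h) :=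
      mul_le_mul_of_nonneg_left (by linarith [hy.1]) hM0
    change G (x0 + h - y) - G x0 ≤ _ at h2
    linarith
  · have hneg := (hint (x0 - h)).neg
    refine key _ (le_integral_of_le_on hneg measurableSet_Icc
      (fun y => neg_le_neg (abs_le.1 (hD _)).2) fun y hy => ?_) ?_
    · have h1 : F (x0 - h - y) ≤ F x0 := hFm (by linarith [hy.1])
      have h2 := hM (x0 - h - y) x0 (by linarith [hy.1])
      have h3 : M * (x0 - (x0 - h - y)) ≤ M * (2 * h) :=
        mul_le_mul_of_nonneg_left (by linarith [hy.2]) hM0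
      change G x0 - G (x0 - h - y) ≤ _ at h2
      simp only [Pi.neg_apply]
      linarith
    · simp only [Pi.neg_apply]
      rw [integral_neg]
      linarith [(abs_le.1 (hR (x0 - h))).1]

/-- Fubini once more; the first moment of `μ` is needed because the inner cosine integral is
dominated by `|x - u|`. -/
lemma integral_fejerLaw_Iic (μ : Measure ℝ) [IsProbabilityMeasure μ] (hμ : Integrable id μ)
    (x : ℝ) : ∫ u, fejerLaw.real (Set.Iic (x - u)) ∂μ = fejerLaw.real (Set.Iic 0) +
      (∫ t in (0 : ℝ)..1, (1 - t) * ∫ u, (∫ y in (0 : ℝ)..(x - u), Real.cos (t * y)) ∂μ) /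
        ∫ y, fejer y := by
  have hz : ∀ u, fejerLaw.real (Set.Iic (x - u)) = fejerLaw.real (Set.Iic 0) +
      (∫ t in (0 : ℝ)..1, (1 - t) * ∫ y in (0 : ℝ)..(x - u), Real.cos (t * y)) /
        ∫ y, fejer y := fun u => by
    rw [fejerLaw_real_Iic, integral_fejer]
  have hcont : Continuous fun p : ℝ × ℝ => ∫ y in (0 : ℝ)..(x - p.2), Real.cos (p.1 * y) := by
    apply intervalIntegral.continuous_parametric_intervalIntegral_of_continuous
    · fun_prop
    · fun_prop
  have hint : Integrable (Function.uncurry fun t u : ℝ =>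
      (1 - t) * ∫ y in (0 : ℝ)..(x - u), Real.cos (t * y))
      ((volume.restrict (Set.uIoc 0 1)).prod μ) := by
    have hb : Integrable (fun p : ℝ × ℝ => |x - p.2|)
        ((volume.restrict (Set.uIoc (0 : ℝ) 1)).prod μ) := by
      have h1 : Integrable (fun u => |x - u|) μ := ((integrable_const x).sub hμ).abs
      have : IsFiniteMeasure (volume.restrict (Set.uIoc (0 : ℝ) 1)) := by
        rw [Set.uIoc_of_le zero_le_one]; infer_instance
      exact h1.comp_snd _
    refine Integrable.mono' hb ?_ ?_
    · refine Continuous.aestronglyMeasurable ?_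
      exact (continuous_const.sub continuous_fst).mul hcont
    · have hmem : ∀ᵐ p ∂((volume.restrict (Set.uIoc (0 : ℝ) 1)).prod μ), p.1 ∈ Set.uIoc (0 : ℝ) 1 :=
        Measure.quasiMeasurePreserving_fst.ae (ae_restrict_mem measurableSet_uIoc)
      filter_upwards [hmem] with p hp
      rw [Set.uIoc_of_le zero_le_one] at hp
      simp only [Function.uncurry, norm_mul, Real.norm_eq_abs]
      calc |1 - p.1| * |∫ y in (0 : ℝ)..(x - p.2), Real.cos (p.1 * y)| ≤ 1 * |x - p.2| := by
            refine mul_le_mul ?_ (abs_integral_cos_mul_le _ _) (abs_nonneg _) zero_le_one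
            exact abs_le.2 ⟨by linarith [hp.1, hp.2], by linarith [hp.1]⟩
        _ = _ := one_mul _
  have hsw := intervalIntegral_integral_swap hint
  simp_rw [hz]
  have hint2 : Integrable (fun u => ∫ t in (0 : ℝ)..1,
      (1 - t) * ∫ y in (0 : ℝ)..(x - u), Real.cos (t * y)) μ := by
    simp_rw [intervalIntegral.integral_of_le zero_le_one]
    rw [Set.uIoc_of_le zero_le_one] at hint
    exact hint.integral_prod_right
  rw [integral_add (integrable_const _) (hint2.div_const _), integral_div, ← hsw]
  simp [integral_const_mul]

/-- The sine integral is, up to sign, the imaginary part of `e^{-itx}` times the characteristic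
function, and `e^{-itx}` has modulus one. -/
lemma integral_sin_sub_le (μ ν : Measure ℝ) [IsProbabilityMeasure μ] [IsProbabilityMeasure ν]
    (t x : ℝ) : |∫ u, Real.sin (t * (x - u)) ∂μ - ∫ u, Real.sin (t * (x - u)) ∂ν| ≤
      ‖charFun μ t - charFun ν t‖ := by
  have h : ∀ (μ : Measure ℝ) [IsProbabilityMeasure μ], ∫ u, Real.sin (t * (x - u)) ∂μ =
      -(Complex.exp (-(t * x * Complex.I)) * charFun μ t).im := by
    intro μ _
    have hi : Integrable (fun u : ℝ => Complex.exp (t * u * Complex.I)) μ := by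
      refine Integrable.mono' (integrable_const 1)
        (Continuous.aestronglyMeasurable (by fun_prop)) (ae_of_all _ fun u => ?_)
      have := Complex.norm_exp_ofReal_mul_I (t * u)
      push_cast at this
      exact this.le
    rw [charFun_apply_real, ← integral_const_mul]
    have := integral_im (hi.const_mul (Complex.exp (-(t * x * Complex.I))))
    simp only [RCLike.im_to_complex] at this
    rw [← this, ← integral_neg]
    congr 1; ext u
    rw [← Complex.exp_add, show -(t * x * Complex.I) + t * u * Complex.I =
      ((-(t * (x - u)) : ℝ) : ℂ) * Complex.I by push_cast; ring, Complex.exp_ofReal_mul_I_im,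
      Real.sin_neg, neg_neg]
  rw [h μ, h ν]
  calc _ = |(Complex.exp (-(t * x * Complex.I)) * (charFun μ t - charFun ν t)).im| := by
        rw [mul_sub, Complex.sub_im, ← abs_neg]; congr 1; ring
    _ ≤ ‖Complex.exp (-(t * x * Complex.I)) * (charFun μ t - charFun ν t)‖ :=
        Complex.abs_im_le_norm _
    _ = _ := by
        rw [norm_mul, show -(t * x * Complex.I) = ((-(t * x) : ℝ) : ℂ) * Complex.I by
          push_cast; ring, Complex.norm_exp_ofReal_mul_I, one_mul]

/-- **Esseen's smoothing inequality**, for characteristic functions compared on `(0, 1]`. -/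
theorem esseen_smoothing : ∃ C : ℝ, 0 < C ∧ ∀ (μ ν : Measure ℝ) [IsProbabilityMeasure μ]
    [IsProbabilityMeasure ν] (_ : Integrable id μ) (_ : Integrable id ν) (M : ℝ) (_ : 0 ≤ M)
    (_ : ∀ x y, x ≤ y → ν.real (Set.Iic y) - ν.real (Set.Iic x) ≤ M * (y - x))
    (H : ℝ → ℝ) (_ : IntervalIntegrable H volume 0 1)
    (_ : ∀ t, 0 < t → t ≤ 1 → ‖charFun μ t - charFun ν t‖ ≤ t * H t) (x : ℝ),
    |μ.real (Set.Iic x) - ν.real (Set.Iic x)| ≤ C * (M + ∫ t in (0 : ℝ)..1, H t) := by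
  obtain ⟨h, hh, hρ⟩ := exists_fejerLaw_Icc
  have hc := integral_fejer_pos
  set c := ∫ y, fejer y with hcdef
  -- The smoothed difference is at most `R = (∫ H) / c`, and desmoothing gives `2R + 4Mh`.
  refine ⟨max (2 / c) (4 * h), by positivity, ?_⟩
  intro μ ν _ _ hμ hν M hM0 hM H hHi hH x
  have hR : ∀ x, |∫ y, (μ.real (Set.Iic (x - y)) - ν.real (Set.Iic (x - y))) ∂fejerLaw| ≤
      (∫ t in (0 : ℝ)..1, H t) / c := by
    intro x
    rw [integral_sub (integrable_cdf_sub _ _ _) (integrable_cdf_sub _ _ _),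
      integral_cdf_sub μ, integral_cdf_sub ν, integral_fejerLaw_Iic μ hμ, integral_fejerLaw_Iic ν hν,
      add_sub_add_left_eq_sub, ← sub_div, abs_div, abs_of_pos hc]
    gcongr
    have hcts : ∀ (μ : Measure ℝ) [IsProbabilityMeasure μ] (_ : Integrable id μ),
        Continuous fun t : ℝ => ∫ u, (∫ y in (0 : ℝ)..(x - u), Real.cos (t * y)) ∂μ := by
      intro μ _ hμ
      refine continuous_of_dominated (bound := fun u => |x - u|) ?_ ?_ ?_ ?_
      · exact fun t => (continuous_integral_cos_mul t x).aestronglyMeasurable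
      · exact fun t => ae_of_all _ fun u => abs_integral_cos_mul_le _ _
      · exact ((integrable_const x).sub hμ).abs
      · refine ae_of_all _ fun u => ?_
        apply intervalIntegral.continuous_parametric_intervalIntegral_of_continuous'
        fun_prop
    have hi : ∀ (μ : Measure ℝ) [IsProbabilityMeasure μ] (_ : Integrable id μ),
        IntervalIntegrable (fun t : ℝ => (1 - t) *
          ∫ u, (∫ y in (0 : ℝ)..(x - u), Real.cos (t * y)) ∂μ) volume 0 1 := fun μ _ hμ =>
      ((continuous_const.sub continuous_id).mul (hcts μ hμ)).intervalIntegrable _ _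
    rw [← intervalIntegral.integral_sub (hi μ hμ) (hi ν hν), ← Real.norm_eq_abs]
    refine intervalIntegral.norm_integral_le_of_norm_le zero_le_one (ae_of_all _ fun t ht => ?_) hHi
    have ht0 := ht.1
    have e : ∀ (μ : Measure ℝ) [IsProbabilityMeasure μ],
        ∫ u, (∫ y in (0 : ℝ)..(x - u), Real.cos (t * y)) ∂μ =
          (∫ u, Real.sin (t * (x - u)) ∂μ) / t := by
      intro μ _
      rw [← integral_div]
      congr 1; ext u
      rw [← integral_cos_mul]
      field_simp
    rw [e μ, e ν, ← mul_sub, ← sub_div, norm_mul, norm_div, Real.norm_eq_abs t, abs_of_pos ht0]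
    calc ‖1 - t‖ * _ ≤ 1 * (t * H t / t) := by
          gcongr
          · exact abs_le.2 ⟨by linarith [ht.2], by linarith⟩
          · exact (integral_sin_sub_le μ ν t x).trans (hH t ht0 ht.2)
      _ = H t := by field_simp
  have hfin := abs_cdf_sub_le_of_smoothed μ ν fejerLaw hM0 hM hh hρ hR x
  have hI0 : 0 ≤ (∫ t in (0 : ℝ)..1, H t) := by
    have := (abs_nonneg _).trans (hR 0)
    rwa [le_div_iff₀ hc, zero_mul] at this
  refine hfin.trans ?_
  have h1 : 2 / c * (∫ t in (0 : ℝ)..1, H t) ≤ max (2 / c) (4 * h) * ∫ t in (0 : ℝ)..1, H t :=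
    mul_le_mul_of_nonneg_right (le_max_left _ _) hI0
  have h2 : 4 * h * M ≤ max (2 / c) (4 * h) * M := mul_le_mul_of_nonneg_right (le_max_right _ _) hM0
  calc 2 * ((∫ t in (0 : ℝ)..1, H t) / c) + 4 * M * h
      = 2 / c * (∫ t in (0 : ℝ)..1, H t) + 4 * h * M := by ring
    _ ≤ _ := by linarith

/-! ### Poissonization of the multinomial counts -/

namespace Occupancy

instance isProbabilityMeasure_ballLaw_uniform {n : ℕ} [NeZero n] :
    IsProbabilityMeasure (ballLaw fun _ : Fin n => 1 / (n : ℝ)) := by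
  constructor
  have hn : (n : ℝ) ≠ 0 := Nat.cast_ne_zero.2 (NeZero.ne n)
  simp only [ballLaw, Measure.coe_finsetSum, Finset.sum_apply, Measure.smul_apply, measure_univ,
    smul_eq_mul, mul_one, Finset.sum_const, Finset.card_univ, Fintype.card_fin]
  rw [nsmul_eq_mul, ← ENNReal.ofReal_natCast, ← ENNReal.ofReal_mul (by positivity),
    mul_one_div_cancel hn, ENNReal.ofReal_one]

instance isProbabilityMeasure_urnLaw_uniform {n : ℕ} [NeZero n] (m : ℕ) :
    IsProbabilityMeasure (urnLaw m fun _ : Fin n => 1 / (n : ℝ)) := by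
  unfold urnLaw; infer_instance

lemma ballLaw_uniform_singleton {n : ℕ} (i : Fin n) :
    ballLaw (fun _ : Fin n => 1 / (n : ℝ)) {i} = ENNReal.ofReal (1 / n) := by
  simp only [ballLaw, Measure.coe_finsetSum, Finset.sum_apply, Measure.smul_apply, smul_eq_mul]
  rw [Finset.sum_eq_single i]
  · simp
  · intro b _ hb
    simp [hb]
  · simp

lemma urnLaw_uniform_singleton {n : ℕ} [NeZero n] (m : ℕ) (ω : Fin m → Fin n) :
    (urnLaw m fun _ : Fin n => 1 / (n : ℝ)).real {ω} = (1 / (n : ℝ)) ^ m := by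
  rw [measureReal_def, urnLaw, Measure.pi_singleton]
  simp_rw [ballLaw_uniform_singleton]
  rw [Finset.prod_const, Finset.card_univ, Fintype.card_fin, ENNReal.toReal_pow,
    ENNReal.toReal_ofReal (by positivity)]

lemma sum_count {m n : ℕ} (ω : Fin m → Fin n) : ∑ i, count i ω = m := by
  have := Finset.card_eq_sum_card_fiberwise (f := ω) (s := Finset.univ) (t := Finset.univ)
    (fun _ _ => Finset.mem_univ _)
  simpa [count] using this.symm

/-- The number of allocations with prescribed counts is a multinomial coefficient. -/
lemma card_filter_count_eq {m n : ℕ} (x : Fin n → ℕ) (hx : ∑ i, x i = m) :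
    (Finset.univ.filter fun ω : Fin m → Fin n => (fun i => count i ω) = x).card =
      Nat.multinomial Finset.univ x := by
  classical
  -- The power `(Σ X_i)^m` is expanded in two ways, by the multinomial theorem and as a sum over
  -- allocations; the coefficients of the monomial with exponent `x` are compared.
  have h1 := Finset.sum_pow_eq_sum_piAntidiag (Finset.univ : Finset (Fin n))
    (fun i => (MvPolynomial.X i : MvPolynomial (Fin n) ℕ)) m
  have h2 : (∑ i : Fin n, (MvPolynomial.X i : MvPolynomial (Fin n) ℕ)) ^ m =
      ∑ ω : Fin m → Fin n, MvPolynomial.monomial (Finsupp.equivFunOnFinite.symm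
        fun i => count i ω) 1 := by
    rw [← Fin.prod_const m (∑ i : Fin n, (MvPolynomial.X i : MvPolynomial (Fin n) ℕ)),
      Finset.prod_univ_sum]
    simp only [Fintype.piFinset_univ]
    refine Finset.sum_congr rfl fun ω _ => ?_
    rw [← Finset.prod_fiberwise' Finset.univ ω, MvPolynomial.monomial_eq]
    simp only [Finset.prod_const, map_one, one_mul]
    rw [Finsupp.prod_fintype _ _ (by simp)]
    rfl
  have h3 : ∀ k : Fin n → ℕ, ((Nat.multinomial Finset.univ k : ℕ) : MvPolynomial (Fin n) ℕ) *
      ∏ i, (MvPolynomial.X i : MvPolynomial (Fin n) ℕ) ^ k i =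
      MvPolynomial.monomial (Finsupp.equivFunOnFinite.symm k) (Nat.multinomial Finset.univ k) := by
    intro k
    rw [MvPolynomial.monomial_eq, Finsupp.prod_fintype _ _ (by simp)]
    simp
  simp_rw [h3] at h1
  rw [h2] at h1
  have h4 := congrArg (MvPolynomial.coeff (Finsupp.equivFunOnFinite.symm x)) h1
  simp only [MvPolynomial.coeff_sum, MvPolynomial.coeff_monomial, EmbeddingLike.apply_eq_iff_eq,
    Finset.sum_ite_eq', Finset.mem_piAntidiag] at h4
  rw [Finset.card_filter, h4]
  simp [hx]

lemma sum_comp_count {m n : ℕ} (F : (Fin n → ℕ) → ℂ) :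
    ∑ ω : Fin m → Fin n, F (fun i => count i ω) =
      ∑ x ∈ Finset.univ.piAntidiag m, (Nat.multinomial Finset.univ x : ℂ) * F x := by
  classical
  rw [← Finset.sum_fiberwise_of_maps_to (s := Finset.univ)
    (t := (Finset.univ : Finset (Fin n)).piAntidiag m) (g := fun ω i => count i ω)]
  · refine Finset.sum_congr rfl fun x hx => ?_
    rw [Finset.mem_piAntidiag] at hx
    rw [← card_filter_count_eq x hx.1, ← nsmul_eq_mul, ← Finset.sum_const]
    refine Finset.sum_congr rfl fun ω hω => ?_
    rw [(Finset.mem_filter.1 hω).2]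
  · intro ω _
    simp [Finset.mem_piAntidiag, sum_count]

/-- Orthogonality of characters: applied to `k = Σ x_i - m`, the integral selects the configurations
with exactly `m` balls. -/
lemma integral_exp_int_mul (k : ℤ) :
    ∫ u in (-Real.pi)..Real.pi, Complex.exp (u * k * Complex.I) =
      if k = 0 then 2 * (Real.pi : ℂ) else 0 := by
  split_ifs with h
  · subst h
    simp
    ring
  · have hk : (k : ℂ) * Complex.I ≠ 0 := by simp [h]
    have h1 : ∀ u : ℝ, Complex.exp (u * k * Complex.I) = Complex.exp (k * Complex.I * u) := by
      intro u; congr 1; ring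
    simp_rw [h1]
    rw [integral_exp_mul_complex hk, div_eq_zero_iff]
    left
    rw [sub_eq_zero, Complex.exp_eq_exp_iff_exists_int]
    exact ⟨k, by push_cast; ring⟩

open scoped NNReal in
/-- Poissonization: `m` uniform balls in `n` urns are independent Poisson counts conditioned on
their sum, and the conditioning is carried out by integrating a Fourier variable. -/
theorem integral_prod_poisson {n : ℕ} [NeZero n] (m : ℕ) (r : ℝ≥0) (hr : (r : ℝ) * n = m)
    (g : Fin n → ℕ → ℂ) (hg : ∀ i, Integrable (g i) (poissonMeasure r)) :
    ∫ u in (-Real.pi)..Real.pi,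
      ∏ i, ∫ k, g i k * Complex.exp (u * ((k - r : ℝ) : ℂ) * Complex.I) ∂(poissonMeasure r) =
      ((2 * Real.pi * (Real.exp (-m) * m ^ m / m.factorial) : ℝ) : ℂ) *
        ∫ ω, ∏ i, g i (count i ω) ∂(urnLaw m fun _ : Fin n => 1 / (n : ℝ)) := by
  classical
  set P := Measure.pi fun _ : Fin n => poissonMeasure r with hP
  have hn : (n : ℝ) ≠ 0 := Nat.cast_ne_zero.2 (NeZero.ne n)
  have hgP : Integrable (fun x : Fin n → ℕ => ∏ i, g i (x i)) P := Integrable.fintype_prod hg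
  -- Independence turns the product into one integral over the product law; the centerings `r` add
  -- up to `r n = m`, so the total exponent is an integer multiple of `u`.
  have h1 : ∀ u : ℝ, ∏ i, ∫ k, g i k * Complex.exp (u * ((k - r : ℝ) : ℂ) * Complex.I)
      ∂(poissonMeasure r) = ∫ x : Fin n → ℕ, (∏ i, g i (x i)) *
        Complex.exp (u * (((∑ i, x i : ℕ) - m : ℤ) : ℂ) * Complex.I) ∂P := by
    intro u
    rw [← integral_fintype_prod_eq_prod]
    congr 1; ext x
    rw [Finset.prod_mul_distrib, ← Complex.exp_sum]
    congr 2
    rw [← Finset.sum_mul, ← Finset.mul_sum]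
    congr 2
    have : (m : ℂ) = (r : ℝ) * n := by exact_mod_cast hr.symm
    push_cast
    rw [Finset.sum_sub_distrib, this]
    simp [mul_comm]
  simp_rw [h1]
  rw [intervalIntegral_integral_swap]
  swap
  · have : IsFiniteMeasure (volume.restrict (Set.uIoc (-Real.pi) Real.pi)) := by
      rw [Set.uIoc]; infer_instance
    have h2 : Integrable (fun p : ℝ × (Fin n → ℕ) => ∏ i, g i (p.2 i))
        ((volume.restrict (Set.uIoc (-Real.pi) Real.pi)).prod P) := hgP.comp_snd _
    refine h2.mul_bdd (c := 1) ?_ (ae_of_all _ fun p => ?_)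
    · have : Measurable fun p : ℝ × (Fin n → ℕ) =>
          Complex.exp (p.1 * (((∑ i, p.2 i : ℕ) - m : ℤ) : ℂ) * Complex.I) := by
        apply measurable_from_prod_countable_left
        intro x
        apply Continuous.measurable
        fun_prop
      exact this.aestronglyMeasurable
    · have := Complex.norm_exp_ofReal_mul_I (p.1 * (((∑ i, p.2 i : ℕ) - m : ℤ) : ℝ))
      push_cast at this ⊢
      exact this.le
  simp_rw [intervalIntegral.integral_const_mul, integral_exp_int_mul]
  have h3 : ∀ x : Fin n → ℕ, (∏ i, g i (x i)) * (if ((∑ i, x i : ℕ) - m : ℤ) = 0 then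
      2 * (Real.pi : ℂ) else 0) = (((Finset.univ : Finset (Fin n)).piAntidiag m : Finset _) :
        Set (Fin n → ℕ)).indicator (fun x => (2 * Real.pi) * ∏ i, g i (x i)) x := by
    intro x
    have : (((∑ i, x i : ℕ) - m : ℤ) = 0) ↔
        x ∈ (((Finset.univ : Finset (Fin n)).piAntidiag m : Finset _) : Set (Fin n → ℕ)) := by
      simp only [Finset.mem_coe, Finset.mem_piAntidiag]
      simp [sub_eq_zero]
      norm_cast
    by_cases hx : x ∈ (((Finset.univ : Finset (Fin n)).piAntidiag m : Finset _) :
        Set (Fin n → ℕ))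
    · rw [Set.indicator_of_mem hx, if_pos (this.2 hx), mul_comm]
    · rw [Set.indicator_of_notMem hx, if_neg (fun h => hx (this.1 h)), mul_zero]
  simp_rw [h3]
  rw [integral_indicator (Finset.measurableSet _), setIntegral_finset _
    (hgP.const_mul _).integrableOn, integral_fintype .of_finite]
  simp_rw [urnLaw_uniform_singleton]
  rw [← Finset.smul_sum, sum_comp_count (fun x => ∏ i, g i (x i)), Finset.smul_sum,
    Finset.mul_sum]
  refine Finset.sum_congr rfl fun x hx => ?_
  have hx := (Finset.mem_piAntidiag.1 hx).1
  -- On configurations with sum `m` the Poisson weight depends on `x` only through `1 / ∏ x_i!`,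
  -- hence is proportional to the multinomial weight.
  have h4 : P.real {x} = Real.exp (-m) * (r : ℝ) ^ m / ∏ i, ((x i).factorial : ℝ) := by
    rw [measureReal_def, hP, Measure.pi_singleton, ENNReal.toReal_prod]
    simp_rw [← measureReal_def, poissonMeasure_real_singleton]
    rw [Finset.prod_div_distrib, Finset.prod_mul_distrib, Finset.prod_pow_eq_pow_sum, hx,
      Finset.prod_const, ← Real.exp_nat_mul]
    congr 3
    simp [← hr, mul_comm]
  have h5 : (∏ i, ((x i).factorial : ℝ)) * (Nat.multinomial Finset.univ x : ℝ) =
      (m.factorial : ℝ) := by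
    have := Nat.multinomial_spec Finset.univ x
    rw [hx] at this
    exact_mod_cast this
  have h6 : (∏ i, ((x i).factorial : ℝ)) ≠ 0 :=
    Finset.prod_ne_zero_iff.2 fun i _ => by positivity
  have h7 : P.real {x} * (2 * Real.pi) = (2 * Real.pi * (Real.exp (-m) * m ^ m / m.factorial)) *
      ((1 / (n : ℝ)) ^ m * (Nat.multinomial Finset.univ x : ℝ)) := by
    have h8 : (r : ℝ) = m / n := by rw [← hr]; field_simp
    rw [h4, h8]
    have h9 : (m.factorial : ℝ) ≠ 0 := by positivity
    rw [← h5] at h9 ⊢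
    have h10 := right_ne_zero_of_mul h9
    field_simp
    rw [div_eq_mul_one_div (m : ℝ), mul_pow]
  rw [Complex.real_smul, Complex.real_smul, ← mul_assoc]
  have h8 := congrArg (fun z : ℝ => (z : ℂ)) h7
  push_cast at h8 ⊢
  rw [h8]
  ring

end Occupancy

/-! ### Expansion of the joint characteristic function -/

lemma norm_exp_ofReal_mul_ofReal_mul_I (t x : ℝ) : ‖Complex.exp (t * x * Complex.I)‖ = 1 := by
  have := Complex.norm_exp_ofReal_mul_I (t * x)
  push_cast at this
  exact this

lemma norm_exp_mul_I_sub_one_le (t x : ℝ) :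
    ‖Complex.exp (t * x * Complex.I) - 1‖ ≤ |t| * |x| := by
  have := Real.norm_exp_I_mul_ofReal_sub_one_le (x := t * x)
  rw [← abs_mul, ← Real.norm_eq_abs]
  convert! this using 3
  push_cast
  ring_nf

/-- Taylor's bound when `|t x| ≤ 1`; otherwise the subtracted terms are themselves dominated by `|t
x| ^ 2`. The cubic version below is split in the same way. -/
lemma norm_exp_mul_I_sub_linear_le (t x : ℝ) :
    ‖Complex.exp (t * x * Complex.I) - 1 - t * x * Complex.I‖ ≤ 2 * (t ^ 2 * x ^ 2) := by
  have hn : ‖(t * x * Complex.I : ℂ)‖ = |t * x| := by simp [abs_mul]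
  have hsq : |t * x| ^ 2 = t ^ 2 * x ^ 2 := by rw [sq_abs]; ring
  rw [← hsq]
  rcases le_or_gt |t * x| 1 with h | h
  · have := Complex.norm_exp_sub_one_sub_id_le (hn.trans_le h)
    rw [hn] at this
    nlinarith [sq_nonneg |t * x|]
  · have h1 := norm_sub_le (Complex.exp (t * x * Complex.I) - 1) (t * x * Complex.I)
    have h2 := norm_exp_mul_I_sub_one_le t x
    rw [← abs_mul] at h2
    rw [hn] at h1
    nlinarith

lemma norm_exp_mul_I_sub_quadratic_le (t x : ℝ) :
    ‖Complex.exp (t * x * Complex.I) - 1 - t * x * Complex.I + t ^ 2 * x ^ 2 / 2‖ ≤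
      3 * (|t| ^ 3 * |x| ^ 3) := by
  have hn : ‖(t * x * Complex.I : ℂ)‖ = |t * x| := by simp [abs_mul]
  have hcu : |t * x| ^ 3 = |t| ^ 3 * |x| ^ 3 := by rw [abs_mul, mul_pow]
  rw [← hcu]
  have hI : (Complex.I) ^ 2 = -1 := Complex.I_sq
  rcases le_or_gt |t * x| 1 with h | h
  · have := Complex.exp_bound (hn.trans_le h) (n := 3) (by norm_num)
    rw [hn] at this
    simp only [Finset.sum_range_succ, Finset.sum_range_zero] at this
    have e : Complex.exp (t * x * Complex.I) - 1 - t * x * Complex.I + t ^ 2 * x ^ 2 / 2 =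
        Complex.exp (t * x * Complex.I) - (0 + (t * x * Complex.I) ^ 0 / (Nat.factorial 0) +
          (t * x * Complex.I) ^ 1 / (Nat.factorial 1) +
          (t * x * Complex.I) ^ 2 / (Nat.factorial 2)) := by
      rw [mul_pow _ Complex.I 2, hI]
      simp
      ring
    rw [e]
    refine this.trans ?_
    rw [mul_comm]
    gcongr
    norm_num [Nat.factorial]
  · have h1 := norm_add_le (Complex.exp (t * x * Complex.I) - 1 - t * x * Complex.I)
      (t ^ 2 * x ^ 2 / 2)
    have h2 := norm_exp_mul_I_sub_linear_le t x
    have h3 : ‖(t ^ 2 * x ^ 2 / 2 : ℂ)‖ = |t * x| ^ 2 / 2 := by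
      simp [abs_mul, mul_pow]
    have h4 : |t * x| ^ 2 = t ^ 2 * x ^ 2 := by rw [sq_abs]; ring
    rw [h3] at h1
    rw [← h4] at h2
    have h5 : |t * x| ^ 2 ≤ |t * x| ^ 3 := pow_le_pow_right₀ h.le (by norm_num)
    linarith [sq_nonneg |t * x|]

/-- `Y` is centered and uncorrelated with `X`, and both are dominated by a function `g ≥ 1` whose
third moment is at most `M`. -/
structure MomentBound (P : Measure ℕ) (Y X g : ℕ → ℝ) (M : ℝ) : Prop where
  one_le : ∀ k, 1 ≤ g k
  abs_fst_le : ∀ k, |Y k| ≤ g k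
  abs_snd_le : ∀ k, |X k| ≤ g k
  integrable : Integrable (fun k => g k ^ 3) P
  integral_le : ∫ k, g k ^ 3 ∂P ≤ M
  integral_fst : ∫ k, Y k ∂P = 0
  integral_mul : ∫ k, Y k * X k ∂P = 0

namespace MomentBound

variable {P : Measure ℕ} {Y X g : ℕ → ℝ} {M : ℝ}

lemma integrable_of_le {E : Type*} [NormedAddCommGroup E] (h : MomentBound P Y X g M) {f : ℕ → E}
    (C : ℝ) (hf : ∀ k, ‖f k‖ ≤ C * g k ^ 3) : Integrable f P :=
  Integrable.mono' (h.integrable.const_mul C) (.of_discrete) (ae_of_all _ hf)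

lemma norm_integral_le_of_le (h : MomentBound P Y X g M) {f : ℕ → ℂ}
    {C : ℝ} (hC : 0 ≤ C) (hf : ∀ k, ‖f k‖ ≤ C * g k ^ 3) : ‖∫ k, f k ∂P‖ ≤ C * M := by
  refine (norm_integral_le_of_norm_le (h.integrable.const_mul C) (ae_of_all _ hf)).trans ?_
  rw [integral_const_mul]
  exact mul_le_mul_of_nonneg_left h.integral_le hC

lemma pow_le (h : MomentBound P Y X g M) (k : ℕ) {j : ℕ} (hj : j ≤ 3) : g k ^ j ≤ g k ^ 3 :=
  pow_le_pow_right₀ (h.one_le k) hj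

lemma pos (h : MomentBound P Y X g M) (k : ℕ) : 0 < g k := zero_lt_one.trans_le (h.one_le k)

lemma sq_fst_le (h : MomentBound P Y X g M) (k : ℕ) : Y k ^ 2 ≤ g k ^ 2 :=
  sq_le_sq' (abs_le.1 (h.abs_fst_le k)).1 (abs_le.1 (h.abs_fst_le k)).2

lemma sq_snd_le (h : MomentBound P Y X g M) (k : ℕ) : X k ^ 2 ≤ g k ^ 2 :=
  sq_le_sq' (abs_le.1 (h.abs_snd_le k)).1 (abs_le.1 (h.abs_snd_le k)).2

lemma integrable_fst (h : MomentBound P Y X g M) : Integrable Y P :=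
  h.integrable_of_le 1 fun k => by
    have := h.pow_le k (j := 1) (by norm_num)
    rw [pow_one] at this
    rw [one_mul]
    exact (h.abs_fst_le k).trans this

lemma integrable_sq (h : MomentBound P Y X g M) : Integrable (fun k => Y k ^ 2) P :=
  h.integrable_of_le 1 fun k => by
    rw [one_mul, Real.norm_eq_abs, abs_of_nonneg (sq_nonneg _)]
    exact (h.sq_fst_le k).trans (h.pow_le k (by norm_num))

lemma integrable_mul (h : MomentBound P Y X g M) : Integrable (fun k => Y k * X k) P :=
  h.integrable_of_le 1 fun k => by
    rw [one_mul, Real.norm_eq_abs, abs_mul]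
    calc |Y k| * |X k| ≤ g k * g k :=
          mul_le_mul (h.abs_fst_le k) (h.abs_snd_le k) (abs_nonneg _) (h.pos k).le
      _ = g k ^ 2 := by ring
      _ ≤ _ := h.pow_le k (by norm_num)

lemma integral_sq_le (h : MomentBound P Y X g M) : ∫ k, Y k ^ 2 ∂P ≤ M :=
  (integral_mono h.integrable_sq h.integrable fun k =>
    (h.sq_fst_le k).trans (h.pow_le k (by norm_num))).trans h.integral_le

lemma integral_sq_nonneg : 0 ≤ ∫ k, Y k ^ 2 ∂P := integral_nonneg fun _ => sq_nonneg _

lemma one_le_bound [IsProbabilityMeasure P] (h : MomentBound P Y X g M) : 1 ≤ M := by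
  have := integral_mono (integrable_const (1 : ℝ)) h.integrable fun k => one_le_pow₀ (h.one_le k)
  simp at this
  exact this.trans h.integral_le

lemma abs_sq_sub_le (h : MomentBound P Y X g M) (k : ℕ) :
    |Y k ^ 2 - ∫ k, Y k ^ 2 ∂P| ≤ (1 + M) * g k ^ 2 := by
  have h1 := h.sq_fst_le k
  have h2 := h.integral_sq_le
  have h3 : 0 ≤ ∫ k, Y k ^ 2 ∂P := integral_sq_nonneg
  have h4 : 1 ≤ g k ^ 2 := one_le_pow₀ (h.one_le k)
  have h5 := sq_nonneg (Y k)
  rw [abs_le]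
  constructor <;> nlinarith

/-- `Y` is orthogonal to `1` and to `X`, so the linear Taylor polynomial of the exponential can be
subtracted for free, leaving second order in `u`. -/
lemma norm_integral_mul_exp_le (h : MomentBound P Y X g M) (u : ℝ) :
    ‖∫ k, (Y k : ℂ) * Complex.exp (u * X k * Complex.I) ∂P‖ ≤ 2 * u ^ 2 * M := by
  have hi1 : Integrable (fun k => (Y k : ℂ) * Complex.exp (u * X k * Complex.I)) P :=
    h.integrable_fst.ofReal.mul_bdd (c := 1) .of_discrete
      (ae_of_all _ fun k => (norm_exp_ofReal_mul_ofReal_mul_I _ _).le)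
  have hi2 : Integrable (fun k => (Y k : ℂ)) P := h.integrable_fst.ofReal
  have hi3 : Integrable (fun k => ((Y k * X k : ℝ) : ℂ) * (u * Complex.I)) P :=
    h.integrable_mul.ofReal.mul_const _
  have e : ∫ k, (Y k : ℂ) * Complex.exp (u * X k * Complex.I) ∂P =
      ∫ k, (Y k : ℂ) * (Complex.exp (u * X k * Complex.I) - 1 - u * X k * Complex.I) ∂P := by
    have : ∀ k, (Y k : ℂ) * (Complex.exp (u * X k * Complex.I) - 1 - u * X k * Complex.I) =
        (Y k : ℂ) * Complex.exp (u * X k * Complex.I) - Y k -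
          ((Y k * X k : ℝ) : ℂ) * (u * Complex.I) := fun k => by push_cast; ring
    simp_rw [this]
    have hi12 : Integrable (fun k => (Y k : ℂ) * Complex.exp (u * X k * Complex.I) - Y k) P :=
      hi1.sub hi2
    rw [integral_sub hi12 hi3, integral_sub hi1 hi2, integral_mul_const,
      integral_complex_ofReal, integral_complex_ofReal, h.integral_fst, h.integral_mul]
    simp
  rw [e]
  refine h.norm_integral_le_of_le (by positivity) fun k => ?_
  rw [norm_mul, Complex.norm_real, Real.norm_eq_abs]
  calc |Y k| * _ ≤ g k * (2 * (u ^ 2 * g k ^ 2)) := by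
        refine mul_le_mul (h.abs_fst_le k) ((norm_exp_mul_I_sub_linear_le _ _).trans ?_)
          (norm_nonneg _) (h.pos k).le
        have := h.sq_snd_le k
        gcongr
    _ = _ := by ring

lemma norm_sq_sub_mul_le (h : MomentBound P Y X g M) (u : ℝ) (k : ℕ) :
    ‖((Y k ^ 2 - ∫ k, Y k ^ 2 ∂P : ℝ) : ℂ) * (Complex.exp (u * X k * Complex.I) - 1)‖ ≤
      |u| * (1 + M) * g k ^ 3 := by
  rw [norm_mul, Complex.norm_real, Real.norm_eq_abs]
  have h1 := h.abs_sq_sub_le k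
  calc _ ≤ (1 + M) * g k ^ 2 * (|u| * g k) := by
        refine mul_le_mul h1 ((norm_exp_mul_I_sub_one_le _ _).trans ?_)
          (norm_nonneg _) ((abs_nonneg _).trans h1)
        exact mul_le_mul_of_nonneg_left (h.abs_snd_le k) (abs_nonneg _)
    _ = _ := by ring

/-- `Y ^ 2` minus its mean is orthogonal only to constants, so only one order in `u` is gained. -/
lemma norm_integral_sq_sub_mul_exp_le [IsProbabilityMeasure P] (h : MomentBound P Y X g M)
    (u : ℝ) : ‖∫ k, ((Y k ^ 2 - ∫ k, Y k ^ 2 ∂P : ℝ) : ℂ) *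
      Complex.exp (u * X k * Complex.I) ∂P‖ ≤ |u| * (1 + M) * M := by
  set s := ∫ k, Y k ^ 2 ∂P with hs
  have hi2 : Integrable (fun k => ((Y k ^ 2 - s : ℝ) : ℂ)) P :=
    (h.integrable_sq.sub (integrable_const _)).ofReal
  have hi1 : Integrable (fun k => ((Y k ^ 2 - s : ℝ) : ℂ) *
      Complex.exp (u * X k * Complex.I)) P :=
    hi2.mul_bdd (c := 1) .of_discrete
      (ae_of_all _ fun k => (norm_exp_ofReal_mul_ofReal_mul_I _ _).le)
  have e : ∫ k, ((Y k ^ 2 - s : ℝ) : ℂ) * Complex.exp (u * X k * Complex.I) ∂P =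
      ∫ k, ((Y k ^ 2 - s : ℝ) : ℂ) * (Complex.exp (u * X k * Complex.I) - 1) ∂P := by
    simp_rw [mul_sub, mul_one]
    rw [integral_sub hi1 hi2, integral_complex_ofReal, integral_sub h.integrable_sq (integrable_const _)]
    simp [hs]
  rw [e]
  have hM := h.one_le_bound
  exact h.norm_integral_le_of_le (by positivity) fun k => h.norm_sq_sub_mul_le u k

/-- Expand in `t` only, keeping the exponential in `u`. The cubic remainder costs `|t|³`; the linear
term costs `|t|u²` by orthogonality of `Y` to `1` and `X`; the quadratic one costs `t²|u|` by
centering. All are within `|t|(t² + u²)`, and the factor `|t|` is what Esseen's inequality requires.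
-/
lemma norm_charFun_sub_le [IsProbabilityMeasure P] (h : MomentBound P Y X g M) (t u : ℝ) :
    ‖∫ k, Complex.exp (t * Y k * Complex.I) * Complex.exp (u * X k * Complex.I) ∂P -
      ((1 - t ^ 2 * (∫ k, Y k ^ 2 ∂P) / 2 : ℝ) : ℂ) *
        ∫ k, Complex.exp (u * X k * Complex.I) ∂P‖ ≤
      ((6 + M) * M) * (|t| * (t ^ 2 + u ^ 2)) := by
  set s := ∫ k, Y k ^ 2 ∂P with hs
  have hM := h.one_le_bound
  have hB : Integrable (fun k => Complex.exp (u * X k * Complex.I)) P :=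
    Integrable.mono' (integrable_const 1) .of_discrete
      (ae_of_all _ fun k => (norm_exp_ofReal_mul_ofReal_mul_I _ _).le)
  have hA : Integrable (fun k => Complex.exp (t * Y k * Complex.I) *
      Complex.exp (u * X k * Complex.I)) P :=
    Integrable.mono' (integrable_const 1) .of_discrete
      (ae_of_all _ fun k => by
        rw [norm_mul, norm_exp_ofReal_mul_ofReal_mul_I, norm_exp_ofReal_mul_ofReal_mul_I, one_mul])
  have h1 : Integrable (fun k => ((1 - t ^ 2 * s / 2 : ℝ) : ℂ) *
      Complex.exp (u * X k * Complex.I)) P := hB.const_mul _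
  have h2 : Integrable (fun k => (t * Complex.I) * (Y k : ℂ)) P :=
    h.integrable_fst.ofReal.const_mul _
  have h3 : Integrable (fun k => (t * u : ℂ) * ((Y k * X k : ℝ) : ℂ)) P :=
    h.integrable_mul.ofReal.const_mul _
  have h4 : Integrable (fun k => (t ^ 2 / 2 : ℂ) * ((Y k ^ 2 - s : ℝ) : ℂ)) P :=
    (h.integrable_sq.sub (integrable_const _)).ofReal.const_mul _
  -- The integrands differ by multiples of `Y`, `Y X` and `Y ^ 2 - s`, all of integral zero.
  have e : ∫ k, Complex.exp (t * Y k * Complex.I) * Complex.exp (u * X k * Complex.I) ∂P -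
      ((1 - t ^ 2 * s / 2 : ℝ) : ℂ) * ∫ k, Complex.exp (u * X k * Complex.I) ∂P =
      ∫ k, ((Complex.exp (t * Y k * Complex.I) - 1 - t * Y k * Complex.I +
          t ^ 2 * Y k ^ 2 / 2) * Complex.exp (u * X k * Complex.I) +
        t * Complex.I * Y k * (Complex.exp (u * X k * Complex.I) - 1 - u * X k * Complex.I) -
        t ^ 2 / 2 * (((Y k ^ 2 - s : ℝ) : ℂ) * (Complex.exp (u * X k * Complex.I) - 1))) ∂P := by
    have : ∀ k, ((Complex.exp (t * Y k * Complex.I) - 1 - t * Y k * Complex.I +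
          t ^ 2 * Y k ^ 2 / 2) * Complex.exp (u * X k * Complex.I) +
        t * Complex.I * Y k * (Complex.exp (u * X k * Complex.I) - 1 - u * X k * Complex.I) -
        t ^ 2 / 2 * (((Y k ^ 2 - s : ℝ) : ℂ) * (Complex.exp (u * X k * Complex.I) - 1))) =
        Complex.exp (t * Y k * Complex.I) * Complex.exp (u * X k * Complex.I) -
        ((1 - t ^ 2 * s / 2 : ℝ) : ℂ) * Complex.exp (u * X k * Complex.I) -
        (t * Complex.I) * (Y k : ℂ) + (t * u : ℂ) * ((Y k * X k : ℝ) : ℂ) +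
        (t ^ 2 / 2 : ℂ) * ((Y k ^ 2 - s : ℝ) : ℂ) := fun k => by
      push_cast
      linear_combination (-(t : ℂ) * u * Y k * X k) * Complex.I_sq
    simp_rw [this]
    have hA1 : Integrable (fun k => Complex.exp (t * Y k * Complex.I) *
        Complex.exp (u * X k * Complex.I) - ((1 - t ^ 2 * s / 2 : ℝ) : ℂ) *
          Complex.exp (u * X k * Complex.I)) P := hA.sub h1
    have hA2 : Integrable (fun k => Complex.exp (t * Y k * Complex.I) *
        Complex.exp (u * X k * Complex.I) - ((1 - t ^ 2 * s / 2 : ℝ) : ℂ) *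
          Complex.exp (u * X k * Complex.I) - (t * Complex.I) * (Y k : ℂ)) P := hA1.sub h2
    have hA3 : Integrable (fun k => Complex.exp (t * Y k * Complex.I) *
        Complex.exp (u * X k * Complex.I) - ((1 - t ^ 2 * s / 2 : ℝ) : ℂ) *
          Complex.exp (u * X k * Complex.I) - (t * Complex.I) * (Y k : ℂ) +
          (t * u : ℂ) * ((Y k * X k : ℝ) : ℂ)) P := hA2.add h3
    rw [integral_add hA3 h4, integral_add hA2 h3, integral_sub hA1 h2, integral_sub hA h1, integral_const_mul, integral_const_mul,
      integral_const_mul, integral_const_mul, integral_complex_ofReal, integral_complex_ofReal, integral_complex_ofReal,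
      integral_sub h.integrable_sq (integrable_const _), h.integral_fst, h.integral_mul]
    simp [hs]
  rw [e]
  have hbound : ∀ k, ‖((Complex.exp (t * Y k * Complex.I) - 1 - t * Y k * Complex.I +
          t ^ 2 * Y k ^ 2 / 2) * Complex.exp (u * X k * Complex.I) +
        t * Complex.I * Y k * (Complex.exp (u * X k * Complex.I) - 1 - u * X k * Complex.I) -
        t ^ 2 / 2 * (((Y k ^ 2 - s : ℝ) : ℂ) * (Complex.exp (u * X k * Complex.I) - 1)))‖ ≤
      ((6 + M) * (|t| * (t ^ 2 + u ^ 2))) * g k ^ 3 := by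
    intro k
    have b1 : ‖(Complex.exp (t * Y k * Complex.I) - 1 - t * Y k * Complex.I +
          t ^ 2 * Y k ^ 2 / 2) * Complex.exp (u * X k * Complex.I)‖ ≤ 3 * (|t| ^ 3 * g k ^ 3) := by
      rw [norm_mul, norm_exp_ofReal_mul_ofReal_mul_I, mul_one]
      refine (norm_exp_mul_I_sub_quadratic_le _ _).trans ?_
      have := h.abs_fst_le k
      gcongr
    have b2 : ‖t * Complex.I * Y k * (Complex.exp (u * X k * Complex.I) - 1 -
        u * X k * Complex.I)‖ ≤ |t| * g k * (2 * (u ^ 2 * g k ^ 2)) := by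
      rw [norm_mul, norm_mul, norm_mul, Complex.norm_I, mul_one, Complex.norm_real,
        Complex.norm_real, Real.norm_eq_abs, Real.norm_eq_abs]
      have := h.abs_fst_le k
      have h2 := h.sq_snd_le k
      have h3 := (norm_exp_mul_I_sub_linear_le u (X k)).trans
        (show _ ≤ 2 * (u ^ 2 * g k ^ 2) by gcongr)
      have h4 := h.pos k
      gcongr
    have b3 : ‖(t ^ 2 / 2 : ℂ) * (((Y k ^ 2 - s : ℝ) : ℂ) *
        (Complex.exp (u * X k * Complex.I) - 1))‖ ≤ t ^ 2 / 2 * (|u| * (1 + M) * g k ^ 3) := by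
      rw [norm_mul]
      have e1 : ‖(t ^ 2 / 2 : ℂ)‖ = t ^ 2 / 2 := by simp
      rw [e1]
      exact mul_le_mul_of_nonneg_left (h.norm_sq_sub_mul_le u k) (by positivity)
    refine (norm_sub_le _ _).trans ((add_le_add (norm_add_le _ _) le_rfl).trans ?_)
    refine (add_le_add (add_le_add b1 b2) b3).trans ?_
    have ht2 : t ^ 2 = |t| ^ 2 := (sq_abs t).symm
    have hu2 : u ^ 2 = |u| ^ 2 := (sq_abs u).symm
    rw [ht2, hu2]
    have hG : 0 ≤ g k ^ 3 := pow_nonneg (h.pos k).le _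
    have ha := abs_nonneg t
    have hb := abs_nonneg u
    have hab : |t| * |u| ≤ |t| ^ 2 + |u| ^ 2 := by nlinarith [sq_nonneg (|t| - |u|)]
    have key : 3 * |t| ^ 3 + 2 * |t| * |u| ^ 2 + |t| ^ 2 / 2 * (|u| * (1 + M)) ≤
        (6 + M) * (|t| * (|t| ^ 2 + |u| ^ 2)) := by
      have : |t| ^ 2 / 2 * (|u| * (1 + M)) ≤ (1 + M) / 2 * (|t| * (|t| ^ 2 + |u| ^ 2)) := by
        have := mul_le_mul_of_nonneg_left hab (show 0 ≤ (1 + M) / 2 * |t| by positivity)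
        nlinarith
      have h7 : 0 ≤ |t| ^ 3 := by positivity
      have h8 : 0 ≤ |t| * |u| ^ 2 := by positivity
      nlinarith
    calc _ = (3 * |t| ^ 3 + 2 * |t| * |u| ^ 2 + |t| ^ 2 / 2 * (|u| * (1 + M))) * g k ^ 3 := by ring
      _ ≤ _ := mul_le_mul_of_nonneg_right key hG
  refine (h.norm_integral_le_of_le (by positivity) hbound).trans (le_of_eq (by ring))

end MomentBound

/-- Factor `a ^ n - b ^ n` as `a - b` times a geometric sum of `n` terms, each at most `q ^ (n -
1)`. -/
lemma norm_pow_sub_pow_le {a b : ℂ} {q : ℝ} (ha : ‖a‖ ≤ q) (hb : ‖b‖ ≤ q) (n : ℕ) :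
    ‖a ^ n - b ^ n‖ ≤ n * ‖a - b‖ * q ^ (n - 1) := by
  have hq : 0 ≤ q := (norm_nonneg _).trans ha
  rw [← (Commute.all a b).mul_geom_sum₂ n, norm_mul, mul_comm (n : ℝ), mul_assoc]
  gcongr
  refine (norm_sum_le _ _).trans ?_
  calc ∑ i ∈ Finset.range n, ‖a ^ i * b ^ (n - 1 - i)‖ ≤ ∑ i ∈ Finset.range n, q ^ (n - 1) := by
        refine Finset.sum_le_sum fun i hi => ?_
        have hi := Finset.mem_range.1 hi
        rw [norm_mul, norm_pow, norm_pow]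
        calc ‖a‖ ^ i * ‖b‖ ^ (n - 1 - i) ≤ q ^ i * q ^ (n - 1 - i) := by gcongr
          _ = q ^ (n - 1) := by rw [← pow_add]; congr 1; omega
    _ = n * q ^ (n - 1) := by simp

/-- Only `t` has to be small: `u` ranges over all of `[-π, π]`. The main term is at most `1 - 2c(t²
+ u²)`, and half of this gain pays for the error term. -/
lemma exists_mul_one_sub_add_le_exp {κ s₀ M K : ℝ} (hκ : 0 < κ) (hs₀ : 0 < s₀) (hM : 0 < M)
    (hK : 0 < K) : ∃ ε c : ℝ, 0 < ε ∧ ε ≤ 1 ∧ 0 < c ∧ c ≤ κ ∧ c ≤ s₀ / 2 ∧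
      ∀ s t u : ℝ, s₀ ≤ s → s ≤ M → |t| ≤ ε → |u| ≤ Real.pi →
        |1 - t ^ 2 * s / 2| * Real.exp (-κ * u ^ 2) + K * (|t| * (t ^ 2 + u ^ 2)) ≤
          Real.exp (-c * (t ^ 2 + u ^ 2)) := by
  set b := Real.exp (-κ * Real.pi ^ 2) with hb
  have hb0 : 0 < b := Real.exp_pos _
  set c3 := κ / (1 + κ * Real.pi ^ 2) with hc3
  have hc30 : 0 < c3 := by positivity
  set c4 := b * s₀ / 2 with hc4
  have hc40 : 0 < c4 := by positivity
  set c := min c3 c4 / 2 with hc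
  have hc0 : 0 < c := by positivity
  have hcc3 : 2 * c ≤ c3 := by rw [hc]; linarith [min_le_left c3 c4]
  have hcc4 : 2 * c ≤ c4 := by rw [hc]; linarith [min_le_right c3 c4]
  have hc3κ : c3 ≤ κ := div_le_self hκ.le (by nlinarith [sq_nonneg Real.pi])
  have hb1 : b ≤ 1 := by
    rw [hb, Real.exp_le_one_iff]
    nlinarith [sq_nonneg Real.pi]
  have hc4s : c4 ≤ s₀ / 2 := by rw [hc4]; nlinarith
  -- `1` and `1 / M` together give `t ^ 2 * s ≤ 1`, which removes the absolute value; `c / K` makes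
  -- the error at most `c (t² + u²)`.
  refine ⟨min 1 (min (1 / M) (c / K)), c, by positivity, min_le_left _ _, hc0, by linarith,
    by linarith, ?_⟩
  intro s t u hs hsM ht hu
  have ht1 : |t| ≤ 1 := ht.trans (min_le_left _ _)
  have ht2 : |t| ≤ 1 / M := ht.trans ((min_le_right _ _).trans (min_le_left _ _))
  have ht3 : |t| ≤ c / K := ht.trans ((min_le_right _ _).trans (min_le_right _ _))
  have htt : t ^ 2 ≤ 1 / M := by
    rw [← sq_abs]
    nlinarith [abs_nonneg t]
  have hts : t ^ 2 * s ≤ 1 := by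
    calc t ^ 2 * s ≤ 1 / M * M := by
          have := hs₀.trans_le hs
          gcongr
      _ = 1 := by field_simp
  have hts0 : 0 ≤ t ^ 2 * s := mul_nonneg (sq_nonneg _) (hs₀.le.trans hs)
  have huu : u ^ 2 ≤ Real.pi ^ 2 := by
    rw [← sq_abs]
    gcongr
  have hE1 : Real.exp (-κ * u ^ 2) ≤ 1 - c3 * u ^ 2 := by
    have h1 : 1 + κ * u ^ 2 ≤ Real.exp (κ * u ^ 2) := by
      linarith [Real.add_one_le_exp (κ * u ^ 2)]
    have h0 : 0 < 1 + κ * u ^ 2 := by positivity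
    have h2 : Real.exp (-κ * u ^ 2) ≤ 1 / (1 + κ * u ^ 2) := by
      rw [neg_mul, Real.exp_neg, ← one_div]
      gcongr
    refine h2.trans ?_
    have h3 : c3 * u ^ 2 ≤ κ * u ^ 2 / (1 + κ * u ^ 2) := by
      rw [hc3, div_mul_eq_mul_div]
      gcongr
    have h4 : 1 / (1 + κ * u ^ 2) = 1 - κ * u ^ 2 / (1 + κ * u ^ 2) := by
      field_simp
      ring
    linarith
  have hE2 : b ≤ Real.exp (-κ * u ^ 2) := by
    rw [hb]
    apply Real.exp_le_exp.2
    nlinarith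
  have hA : |1 - t ^ 2 * s / 2| = 1 - t ^ 2 * s / 2 := abs_of_nonneg (by linarith)
  rw [hA]
  have hmain : (1 - t ^ 2 * s / 2) * Real.exp (-κ * u ^ 2) ≤ 1 - c3 * u ^ 2 - c4 * t ^ 2 := by
    have h1 : c4 * t ^ 2 ≤ t ^ 2 * s / 2 * Real.exp (-κ * u ^ 2) := by
      calc c4 * t ^ 2 = t ^ 2 * s₀ / 2 * b := by rw [hc4]; ring
        _ ≤ _ := by gcongr
    nlinarith
  have hK1 : K * (|t| * (t ^ 2 + u ^ 2)) ≤ c * (t ^ 2 + u ^ 2) := by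
    rw [← mul_assoc]
    gcongr
    calc K * |t| ≤ K * (c / K) := by gcongr
      _ = c := by field_simp
  calc _ ≤ 1 - c3 * u ^ 2 - c4 * t ^ 2 + c * (t ^ 2 + u ^ 2) := add_le_add hmain hK1
    _ ≤ -c * (t ^ 2 + u ^ 2) + 1 := by nlinarith [sq_nonneg t, sq_nonneg u]
    _ ≤ _ := Real.add_one_le_exp _

lemma abs_exp_neg_sub_le {x : ℝ} (hx : 0 ≤ x) : |Real.exp (-x) - (1 - x)| ≤ x ^ 2 := by
  rw [abs_of_nonneg (by linarith [Real.add_one_le_exp (-x)])]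
  have h1 : Real.exp (-x) ≤ 1 / (1 + x) := by
    rw [Real.exp_neg, ← one_div]
    have := Real.add_one_le_exp x
    gcongr
    linarith
  have h2 : 1 / (1 + x) ≤ 1 - x + x ^ 2 := by
    rw [div_le_iff₀ (by positivity)]
    nlinarith [pow_nonneg hx 3]
  linarith

/-- The powers of the joint characteristic function of `(Y, X)` are close to those of the product
of a Gaussian characteristic function and that of `X`. -/
theorem exists_charFun_pow_sub_le {κ s₀ M : ℝ} (hκ : 0 < κ) (hs₀ : 0 < s₀) (hM : 0 < M) :
    ∃ ε c K : ℝ, 0 < ε ∧ ε ≤ 1 ∧ 0 < c ∧ 0 < K ∧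
      ∀ (P : Measure ℕ) [IsProbabilityMeasure P] (Y X g : ℕ → ℝ), MomentBound P Y X g M →
      s₀ ≤ ∫ k, Y k ^ 2 ∂P → (∀ u : ℝ, |u| ≤ Real.pi →
        ‖∫ k, Complex.exp (u * X k * Complex.I) ∂P‖ ≤ Real.exp (-κ * u ^ 2)) →
      ∀ (n : ℕ) (t u : ℝ), |t| ≤ ε → |u| ≤ Real.pi →
      ‖(∫ k, Complex.exp (t * Y k * Complex.I) * Complex.exp (u * X k * Complex.I) ∂P) ^ n -
        (Real.exp (-(n * (t ^ 2 * (∫ k, Y k ^ 2 ∂P) / 2))) : ℂ) *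
          (∫ k, Complex.exp (u * X k * Complex.I) ∂P) ^ n‖ ≤
      n * (K * (|t| * (t ^ 2 + u ^ 2))) * Real.exp (-c * (t ^ 2 + u ^ 2)) ^ (n - 1) := by
  obtain ⟨ε, c, hε, hε1, hc, hcκ, hcs, H⟩ :=
    exists_mul_one_sub_add_le_exp (K := (6 + M) * M) hκ hs₀ hM (by positivity)
  refine ⟨ε, c, (6 + M) * M + M ^ 2, hε, hε1, hc, by positivity, ?_⟩
  intro P _ Y X g h hs hB n t u ht hu
  have hE1 := h.norm_charFun_sub_le t u
  have hsM := h.integral_sq_le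
  have hBu := hB u hu
  set s := ∫ k, Y k ^ 2 ∂P with hsdef
  set A := ∫ k, Complex.exp (t * Y k * Complex.I) * Complex.exp (u * X k * Complex.I) ∂P
  set B := ∫ k, Complex.exp (u * X k * Complex.I) ∂P
  have hs0 : 0 < s := hs₀.trans_le hs
  -- Both bases of the powers get the same exponential bound, as the telescoping estimate requires.
  have hA : ‖A‖ ≤ Real.exp (-c * (t ^ 2 + u ^ 2)) := by
    refine le_trans ?_ (H s t u hs hsM ht hu)
    have h1 := norm_le_norm_add_norm_sub' A (((1 - t ^ 2 * s / 2 : ℝ) : ℂ) * B)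
    rw [norm_mul, Complex.norm_real, Real.norm_eq_abs] at h1
    refine h1.trans (add_le_add ?_ hE1)
    gcongr
  have hD : ‖(Real.exp (-(t ^ 2 * s / 2)) : ℂ) * B‖ ≤ Real.exp (-c * (t ^ 2 + u ^ 2)) := by
    rw [norm_mul, Complex.norm_real, Real.norm_eq_abs, Real.abs_exp]
    calc _ ≤ Real.exp (-(t ^ 2 * s / 2)) * Real.exp (-κ * u ^ 2) := by gcongr
      _ = Real.exp (-(t ^ 2 * s / 2) + -κ * u ^ 2) := (Real.exp_add _ _).symm
      _ ≤ _ := by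
        apply Real.exp_le_exp.2
        nlinarith [sq_nonneg t, sq_nonneg u]
  have hAD : ‖A - (Real.exp (-(t ^ 2 * s / 2)) : ℂ) * B‖ ≤
      ((6 + M) * M + M ^ 2) * (|t| * (t ^ 2 + u ^ 2)) := by
    have e : A - (Real.exp (-(t ^ 2 * s / 2)) : ℂ) * B = (A - ((1 - t ^ 2 * s / 2 : ℝ) : ℂ) * B) -
        ((Real.exp (-(t ^ 2 * s / 2)) - (1 - t ^ 2 * s / 2) : ℝ) : ℂ) * B := by
      push_cast; ring
    rw [e]
    refine (norm_sub_le _ _).trans ?_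
    rw [add_mul]
    refine add_le_add hE1 ?_
    rw [norm_mul, Complex.norm_real, Real.norm_eq_abs]
    have hB1 : ‖B‖ ≤ 1 := hBu.trans (Real.exp_le_one_iff.2 (by nlinarith [sq_nonneg u]))
    have ht1 : |t| ≤ 1 := ht.trans hε1
    have h0 := abs_nonneg t
    calc _ ≤ (t ^ 2 * s / 2) ^ 2 * 1 := by
          gcongr
          exact abs_exp_neg_sub_le (by positivity)
      _ ≤ (t ^ 2 * M) ^ 2 := by
          rw [mul_one]
          gcongr
          nlinarith [sq_nonneg t]
      _ = M ^ 2 * (|t| * |t| ^ 3) := by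
          rw [← sq_abs t]; ring
      _ ≤ M ^ 2 * (1 * |t| ^ 3) := by gcongr
      _ ≤ M ^ 2 * (|t| * (t ^ 2 + u ^ 2)) := by
          rw [← sq_abs t]
          refine mul_le_mul_of_nonneg_left ?_ (sq_nonneg M)
          nlinarith [mul_nonneg h0 (sq_nonneg u)]
  have hpow : (Real.exp (-(n * (t ^ 2 * s / 2))) : ℂ) * B ^ n =
      ((Real.exp (-(t ^ 2 * s / 2)) : ℂ) * B) ^ n := by
    rw [mul_pow, ← Complex.ofReal_pow, ← Real.exp_nat_mul]
    congr 3
    ring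
  rw [hpow]
  refine (norm_pow_sub_pow_le hA hD n).trans ?_
  gcongr

/-! ### Poisson moments and the regression residual -/

section Poisson

open scoped NNReal

lemma hasSum_exp_mul_poissonMeasure (r : ℝ≥0) (C : ℝ) :
    HasSum (fun k : ℕ => Real.exp (-r) * r ^ k / k.factorial * Real.exp (C * k))
      (Real.exp (r * (Real.exp C - 1))) := by
  have h := (NormedSpace.expSeries_div_hasSum_exp (r * Real.exp C)).mul_left (Real.exp (-r))
  rw [← Real.exp_eq_exp_ℝ, ← Real.exp_add] at h
  convert! h using 1
  · ext k
    rw [mul_pow, ← Real.exp_nat_mul, mul_comm C]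
    ring
  · congr 1
    ring

lemma integrable_exp_mul_poissonMeasure (r : ℝ≥0) (C : ℝ) :
    Integrable (fun k : ℕ => Real.exp (C * k)) (poissonMeasure r) := by
  rw [integrable_poissonMeasure_iff]
  simpa using (hasSum_exp_mul_poissonMeasure r C).summable

lemma integral_exp_mul_poissonMeasure (r : ℝ≥0) (C : ℝ) :
    ∫ k : ℕ, Real.exp (C * k) ∂(poissonMeasure r) = Real.exp (r * (Real.exp C - 1)) := by
  rw [integral_poissonMeasure]
  simpa using (hasSum_exp_mul_poissonMeasure r C).tsum_eq

lemma integrable_poissonMeasure_of_le_exp {r : ℝ≥0} {f : ℕ → ℝ} (A C : ℝ)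
    (hf : ∀ k, |f k| ≤ A * Real.exp (C * k)) : Integrable f (poissonMeasure r) :=
  Integrable.mono' ((integrable_exp_mul_poissonMeasure r C).const_mul A) .of_discrete
    (ae_of_all _ hf)

lemma abs_integral_poissonMeasure_le {r : ℝ≥0} {f : ℕ → ℝ} (A C : ℝ)
    (hf : ∀ k, |f k| ≤ A * Real.exp (C * k)) :
    |∫ k, f k ∂(poissonMeasure r)| ≤ A * Real.exp (r * (Real.exp C - 1)) := by
  have := norm_integral_le_of_norm_le (f := f)
    ((integrable_exp_mul_poissonMeasure r C).const_mul A) (ae_of_all _ hf)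
  rwa [integral_const_mul, integral_exp_mul_poissonMeasure] at this

/-- The Stein–Chen identity. -/
lemma integral_natCast_mul_poissonMeasure {r : ℝ≥0} {f : ℕ → ℝ}
    (hf : Integrable (fun k => k * f k) (poissonMeasure r)) :
    ∫ k, k * f k ∂(poissonMeasure r) = r * ∫ k, f (k + 1) ∂(poissonMeasure r) := by
  have h := hasSum_integral_poissonMeasure hf
  have e : ∀ k : ℕ, (Real.exp (-r) * r ^ (k + 1) / (k + 1).factorial) •
      (((k + 1 : ℕ) : ℝ) * f (k + 1)) =
      r * ((Real.exp (-r) * r ^ k / k.factorial) • f (k + 1)) := by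
    intro k
    rw [Nat.factorial_succ, smul_eq_mul, smul_eq_mul]
    push_cast
    have : (k.factorial : ℝ) ≠ 0 := by positivity
    have : (k + 1 : ℝ) ≠ 0 := by positivity
    field_simp
    ring
  rw [← h.tsum_eq, integral_poissonMeasure, h.summable.tsum_eq_zero_add, ← tsum_mul_left]
  simp_rw [e]
  simp

lemma natCast_le_exp (k : ℕ) : (k : ℝ) ≤ Real.exp (1 * k) := by
  rw [one_mul]; linarith [Real.add_one_le_exp (k : ℝ)]

lemma integrable_natCast_poissonMeasure (r : ℝ≥0) :
    Integrable (fun k : ℕ => (k : ℝ)) (poissonMeasure r) :=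
  integrable_poissonMeasure_of_le_exp 1 1 fun k => by
    rw [one_mul, abs_of_nonneg (by positivity)]; exact natCast_le_exp k

lemma integrable_natCast_sq_poissonMeasure (r : ℝ≥0) :
    Integrable (fun k : ℕ => (k : ℝ) * k) (poissonMeasure r) :=
  integrable_poissonMeasure_of_le_exp 1 2 fun k => by
    rw [one_mul, abs_of_nonneg (by positivity), show (2 : ℝ) * k = 1 * k + 1 * k by ring,
      Real.exp_add]
    have := natCast_le_exp k
    gcongr

lemma integral_natCast_poissonMeasure (r : ℝ≥0) : ∫ k : ℕ, (k : ℝ) ∂(poissonMeasure r) = r := by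
  have := integral_natCast_mul_poissonMeasure (r := r) (f := fun _ => 1)
    (by simpa using integrable_natCast_poissonMeasure r)
  simpa using this

lemma integral_sub_poissonMeasure (r : ℝ≥0) :
    ∫ k : ℕ, ((k : ℝ) - r) ∂(poissonMeasure r) = 0 := by
  rw [integral_sub (integrable_natCast_poissonMeasure r) (integrable_const _),
    integral_natCast_poissonMeasure]
  simp

lemma integral_sub_mul_sub_poissonMeasure (r : ℝ≥0) :
    ∫ k : ℕ, ((k : ℝ) - r) * (k - r) ∂(poissonMeasure r) = r := by
  have hi := integrable_natCast_poissonMeasure r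
  have h1 := integral_natCast_mul_poissonMeasure (r := r) (f := fun k => (k : ℝ))
    (integrable_natCast_sq_poissonMeasure r)
  have h2 : ∫ k : ℕ, (((k + 1 : ℕ)) : ℝ) ∂(poissonMeasure r) = r + 1 := by
    push_cast
    rw [integral_add hi (integrable_const _), integral_natCast_poissonMeasure]
    simp
  rw [h2] at h1
  have e : ∀ k : ℕ, ((k : ℝ) - r) * (k - r) = (k : ℝ) * k - r * k - r * (k - r) := fun k => by
    ring
  simp_rw [e]
  have hi2 : Integrable (fun k : ℕ => (k : ℝ) * k - r * k) (poissonMeasure r) :=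
    (integrable_natCast_sq_poissonMeasure r).sub (hi.const_mul _)
  have hi3 : Integrable (fun k : ℕ => (r : ℝ) * (k - r)) (poissonMeasure r) :=
    (hi.sub (integrable_const _)).const_mul _
  rw [integral_sub hi2 hi3, integral_sub (integrable_natCast_sq_poissonMeasure r)
    (hi.const_mul _), integral_const_mul, integral_const_mul, integral_sub_poissonMeasure,
    integral_natCast_poissonMeasure, h1]
  ring

/-- The modulus is exactly `exp (-r (1 - cos u))`, and `1 - cos u ≥ 2u²/π²` on `[-π, π]`. -/
lemma norm_integral_exp_poissonMeasure_le {r : ℝ≥0} {l : ℝ} (hr : l ≤ r) {u : ℝ}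
    (hu : |u| ≤ Real.pi) :
    ‖∫ k : ℕ, Complex.exp (u * ((k - r : ℝ) : ℂ) * Complex.I) ∂(poissonMeasure r)‖ ≤
      Real.exp (-(l * (2 / Real.pi ^ 2)) * u ^ 2) := by
  have h := charFun_map_cast_poissonMeasure r u
  rw [charFun_apply_real, integral_map .of_discrete
    (Continuous.aestronglyMeasurable (by fun_prop))] at h
  have e : ∀ k : ℕ, Complex.exp (u * ((k - r : ℝ) : ℂ) * Complex.I) =
      Complex.exp (u * ((-r : ℝ) : ℂ) * Complex.I) *
        Complex.exp (u * ((k : ℝ) : ℂ) * Complex.I) := fun k => by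
    rw [← Complex.exp_add]
    congr 1
    push_cast
    ring
  simp_rw [e]
  rw [integral_const_mul, h, norm_mul, norm_exp_ofReal_mul_ofReal_mul_I, one_mul, Complex.norm_exp]
  apply Real.exp_le_exp.2
  have hc := Real.cos_le_one_sub_mul_cos_sq hu
  have hc1 : 0 ≤ 1 - Real.cos u := by linarith [Real.cos_le_one u]
  have e2 : ((r : ℂ) * (Complex.exp (u * Complex.I) - 1)).re = -(r * (1 - Real.cos u)) := by
    have h0 : ((r : ℂ)) = ((r : ℝ) : ℂ) := rfl
    rw [h0, Complex.re_ofReal_mul, Complex.sub_re, Complex.exp_ofReal_mul_I_re, Complex.one_re]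
    ring
  rw [e2]
  have h1 : 2 / Real.pi ^ 2 * u ^ 2 ≤ 1 - Real.cos u := by linarith
  have h2 : 0 ≤ 2 / Real.pi ^ 2 * u ^ 2 := by positivity
  have h3 : l * (2 / Real.pi ^ 2 * u ^ 2) ≤ r * (1 - Real.cos u) :=
    mul_le_mul hr h1 h2 r.2
  linarith

end Poisson

/-- A nonzero second difference witnesses nonlinearity in a form unaffected by subtracting a linear
function, whatever the regression coefficients are. -/
lemma exists_second_difference_ne_zero {φ : ℕ → ℝ}
    (h : ¬ ∃ a b : ℝ, ∀ x : ℕ, φ x = a + b * (x : ℝ)) :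
    ∃ j, φ (j + 2) - 2 * φ (j + 1) + φ j ≠ 0 := by
  by_contra! hc
  refine h ⟨φ 0, φ 1 - φ 0, fun x => ?_⟩
  induction x using Nat.twoStepInduction with
  | zero => simp
  | one => simp
  | more n h1 h2 =>
    have := hc n
    push_cast at h2 ⊢
    linarith

section Poisson

open scoped NNReal

/-- A function that is not linear has residual variance bounded below under Poisson laws with
parameters in a compact subinterval of `(0, ∞)`. -/
lemma exists_le_integral_sq_sub_linear {φ : ℕ → ℝ}
    (h : ¬ ∃ a b : ℝ, ∀ x : ℕ, φ x = a + b * (x : ℝ)) {l₁ l₂ : ℝ} (hl₁ : 0 < l₁) :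
    ∃ s₀ : ℝ, 0 < s₀ ∧ ∀ r : ℝ≥0, l₁ ≤ r → r ≤ l₂ → ∀ (Y : ℕ → ℝ) (a b : ℝ),
      (∀ k : ℕ, Y k = φ k - a - b * (k - r)) →
      Integrable (fun k => Y k ^ 2) (poissonMeasure r) →
      s₀ ≤ ∫ k, Y k ^ 2 ∂(poissonMeasure r) := by
  obtain ⟨j, hj⟩ := exists_second_difference_ne_zero h
  set D := φ (j + 2) - 2 * φ (j + 1) + φ j with hD
  set q := min 1 l₁ with hq
  have hq0 : 0 < q := by positivity
  -- A lower bound for the Poisson masses of `j`, `j + 1`, `j + 2`, uniform in `r ∈ [l₁, l₂]`; since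
  -- `q ≤ 1`, the largest exponent covers all three.
  set w := Real.exp (-l₂) * q ^ (j + 2) / (j + 2).factorial with hw
  have hw0 : 0 < w := by positivity
  refine ⟨w * (D ^ 2 / 6), by positivity, ?_⟩
  intro r hr1 hr2 Y a b hY hi
  have hwk : ∀ k, k ≤ j + 2 → w ≤ (poissonMeasure r).real {k} := by
    intro k hk
    rw [poissonMeasure_real_singleton, hw]
    have h1 : q ^ (j + 2) ≤ (r : ℝ) ^ k := by
      calc q ^ (j + 2) ≤ q ^ k := pow_le_pow_of_le_one hq0.le (min_le_left _ _) hk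
        _ ≤ (r : ℝ) ^ k := by
          gcongr
          exact (min_le_right _ _).trans hr1
    have h2 : (k.factorial : ℝ) ≤ (j + 2).factorial := by
      exact_mod_cast Nat.factorial_le hk
    gcongr
  have h1 : ∑ k ∈ {j, j + 1, j + 2}, (poissonMeasure r).real {k} * Y k ^ 2 ≤
      ∫ k, Y k ^ 2 ∂(poissonMeasure r) := by
    have := setIntegral_finset (μ := poissonMeasure r) ({j, j + 1, j + 2} : Finset ℕ)
      hi.integrableOn
    simp only [smul_eq_mul] at this
    rw [← this]
    exact setIntegral_le_integral hi (ae_of_all _ fun k => sq_nonneg _)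
  refine le_trans ?_ h1
  rw [Finset.sum_insert (by simp), Finset.sum_insert (by simp), Finset.sum_singleton]
  have hDY : D = Y (j + 2) - 2 * Y (j + 1) + Y j := by
    rw [hY, hY, hY, hD]
    push_cast
    ring
  -- Cauchy–Schwarz against the vector `(1, -2, 1)`, of squared length `6`.
  have h2 : D ^ 2 / 6 ≤ Y j ^ 2 + (Y (j + 1) ^ 2 + Y (j + 2) ^ 2) := by
    rw [hDY]
    nlinarith [sq_nonneg (Y (j + 2) * 2 + Y (j + 1)), sq_nonneg (Y j * 2 + Y (j + 1)),
      sq_nonneg (Y j - Y (j + 2))]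
  calc w * (D ^ 2 / 6) ≤ w * (Y j ^ 2 + (Y (j + 1) ^ 2 + Y (j + 2) ^ 2)) := by gcongr
    _ = w * Y j ^ 2 + (w * Y (j + 1) ^ 2 + w * Y (j + 2) ^ 2) := by ring
    _ ≤ _ := by
      have := hwk j (by omega)
      have := hwk (j + 1) (by omega)
      have := hwk (j + 2) le_rfl
      gcongr

/-- The residual of `φ` after regression on the Poisson variable, with moment bounds that are
uniform over compact sets of parameters. -/
theorem exists_poisson_residual {φ : ℕ → ℝ} {K : ℝ} (hK : 0 < K)
    (hgrowth : ∀ x : ℕ, |φ x| ≤ K * Real.exp (K * (x : ℝ)))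
    (h : ¬ ∃ a b : ℝ, ∀ x : ℕ, φ x = a + b * (x : ℝ)) {l₁ l₂ : ℝ} (hl₁ : 0 < l₁) :
    ∃ s₀ M κ : ℝ, 0 < s₀ ∧ 0 < M ∧ 0 < κ ∧ ∀ r : ℝ≥0, l₁ ≤ r → r ≤ l₂ →
      ∃ (Y g : ℕ → ℝ) (a b : ℝ), (∀ k : ℕ, Y k = φ k - a - b * (k - r)) ∧
        MomentBound (poissonMeasure r) Y (fun k => (k : ℝ) - r) g M ∧
        s₀ ≤ ∫ k, Y k ^ 2 ∂(poissonMeasure r) ∧ ∀ u : ℝ, |u| ≤ Real.pi →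
        ‖∫ k : ℕ, Complex.exp (u * ((k - r : ℝ) : ℂ) * Complex.I) ∂(poissonMeasure r)‖ ≤
          Real.exp (-κ * u ^ 2) := by
  obtain ⟨s₀, hs₀, hs⟩ := exists_le_integral_sq_sub_linear (l₂ := l₂) h hl₁
  -- No sign is assumed for `l₂`; `L` is a nonnegative upper bound for `r`.
  set L := max l₂ 0 with hL
  have hL0 : 0 ≤ L := le_max_right _ _
  set A₀ := K * Real.exp (L * (Real.exp K - 1)) with hA₀
  set B₀ := K * (1 + L) * Real.exp (L * (Real.exp (K + 1) - 1)) / l₁ with hB₀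
  -- The first three terms dominate `φ`, `a` and `b (k - r)`; the extra `1 + L` dominates `k - r`
  -- and gives `g ≥ 1`.
  set C := K + A₀ + B₀ * (1 + L) + (1 + L) with hC
  have hA₀0 : 0 < A₀ := by positivity
  have hB₀0 : 0 < B₀ := by positivity
  have hC0 : 0 < C := by positivity
  have hC1 : 1 ≤ C := by
    have : 0 ≤ B₀ * (1 + L) := by positivity
    linarith
  refine ⟨s₀, C ^ 3 * Real.exp (L * (Real.exp (3 * (K + 1)) - 1)), l₁ * (2 / Real.pi ^ 2), hs₀,
    by positivity, by positivity, ?_⟩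
  intro r hr1 hr2
  have hrL : (r : ℝ) ≤ L := hr2.trans (le_max_left _ _)
  have hr0 : 0 < (r : ℝ) := hl₁.trans_le hr1
  set P := poissonMeasure r with hP
  have hexp : ∀ c, 0 ≤ c → Real.exp (r * (Real.exp c - 1)) ≤ Real.exp (L * (Real.exp c - 1)) := by
    intro c hc
    have : 0 ≤ Real.exp c - 1 := by linarith [Real.one_le_exp hc]
    gcongr
  have hX : ∀ k : ℕ, |(k : ℝ) - r| ≤ (1 + L) * Real.exp (1 * k) := by
    intro k
    have h1 := natCast_le_exp k
    have h2 : 1 ≤ Real.exp (1 * (k : ℝ)) := Real.one_le_exp (by positivity)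
    have h3 : (0 : ℝ) ≤ k := by positivity
    rw [abs_le]
    constructor <;> nlinarith
  have hφX : ∀ k : ℕ, |φ k * (k - r)| ≤ K * (1 + L) * Real.exp ((K + 1) * k) := by
    intro k
    rw [abs_mul]
    calc |φ k| * |(k : ℝ) - r| ≤ (K * Real.exp (K * k)) * ((1 + L) * Real.exp (1 * k)) :=
          mul_le_mul (hgrowth k) (hX k) (abs_nonneg _) (by positivity)
      _ = K * (1 + L) * (Real.exp (K * k) * Real.exp (1 * k)) := by ring
      _ = _ := by rw [← Real.exp_add, ← add_mul]
  have hφi : Integrable φ P := integrable_poissonMeasure_of_le_exp _ _ hgrowth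
  have hφXi : Integrable (fun k : ℕ => φ k * (k - r)) P :=
    integrable_poissonMeasure_of_le_exp _ _ hφX
  have hXi : Integrable (fun k : ℕ => (k : ℝ) - r) P :=
    integrable_poissonMeasure_of_le_exp _ _ hX
  have hXXi : Integrable (fun k : ℕ => ((k : ℝ) - r) * (k - r)) P :=
    integrable_poissonMeasure_of_le_exp ((1 + L) ^ 2) 2 fun k => by
      rw [abs_mul]
      calc _ ≤ ((1 + L) * Real.exp (1 * k)) * ((1 + L) * Real.exp (1 * k)) :=
            mul_le_mul (hX k) (hX k) (abs_nonneg _) (by positivity)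
        _ = (1 + L) ^ 2 * (Real.exp (1 * k) * Real.exp (1 * k)) := by ring
        _ = _ := by rw [← Real.exp_add, ← add_mul]; norm_num
  set a := ∫ k, φ k ∂P with ha
  -- Covariance with the Poisson variable divided by its variance `r`, which makes the residual
  -- uncorrelated with it.
  set b := (∫ k, φ k * (k - r) ∂P) / r with hb
  have haA : |a| ≤ A₀ := (abs_integral_poissonMeasure_le _ _ hgrowth).trans
    (mul_le_mul_of_nonneg_left (hexp K hK.le) hK.le)
  have hbB : |b| ≤ B₀ := by
    rw [hb, hB₀, abs_div, abs_of_pos hr0]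
    have h1 := (abs_integral_poissonMeasure_le (r := r) _ _ hφX).trans
      (mul_le_mul_of_nonneg_left (hexp (K + 1) (by positivity)) (by positivity))
    gcongr
  set Y : ℕ → ℝ := fun k => φ k - a - b * (k - r) with hY
  set g : ℕ → ℝ := fun k => C * Real.exp ((K + 1) * k) with hg
  have hYg : ∀ k, |Y k| ≤ g k := by
    intro k
    have h1 : |Y k| ≤ |φ k| + |a| + |b| * |(k : ℝ) - r| := by
      rw [hY, ← abs_mul]
      exact (abs_sub _ _).trans (add_le_add (abs_sub _ _) le_rfl)
    have hk : (0 : ℝ) ≤ k := by positivity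
    have h2 : Real.exp (K * k) ≤ Real.exp ((K + 1) * k) := by
      apply Real.exp_le_exp.2; nlinarith
    have h3 : Real.exp (1 * k) ≤ Real.exp ((K + 1) * k) := by
      apply Real.exp_le_exp.2; nlinarith
    have h4 : 1 ≤ Real.exp ((K + 1) * k) := Real.one_le_exp (by positivity)
    calc |Y k| ≤ K * Real.exp ((K + 1) * k) + A₀ * Real.exp ((K + 1) * k) +
          B₀ * ((1 + L) * Real.exp ((K + 1) * k)) := by
          refine h1.trans (add_le_add (add_le_add ?_ ?_) ?_)
          · exact (hgrowth k).trans (by gcongr)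
          · exact haA.trans (le_mul_of_one_le_right hA₀0.le h4)
          · exact mul_le_mul hbB ((hX k).trans (by gcongr)) (abs_nonneg _) hB₀0.le
      _ ≤ _ := by
        rw [hg, hC]
        have : 0 ≤ (1 + L) * Real.exp ((K + 1) * k) := by positivity
        nlinarith
  have hg3 : ∀ k : ℕ, g k ^ 3 = C ^ 3 * Real.exp (3 * (K + 1) * k) := by
    intro k
    rw [hg, mul_pow, ← Real.exp_nat_mul]
    congr 2
    push_cast
    ring
  have hmb : MomentBound P Y (fun k => (k : ℝ) - r) g
      (C ^ 3 * Real.exp (L * (Real.exp (3 * (K + 1)) - 1))) :=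
    { one_le := fun k => one_le_mul_of_one_le_of_one_le hC1 (Real.one_le_exp (by positivity))
      abs_fst_le := hYg
      abs_snd_le := fun k => by
        refine (hX k).trans ?_
        have hk : (0 : ℝ) ≤ k := by positivity
        have h5 : 1 + L ≤ C := by
          have : 0 ≤ B₀ * (1 + L) := by positivity
          linarith
        change (1 + L) * Real.exp (1 * k) ≤ C * Real.exp ((K + 1) * k)
        gcongr
        linarith
      integrable := by
        simp_rw [hg3]
        exact (integrable_exp_mul_poissonMeasure r _).const_mul _
      integral_le := by
        simp_rw [hg3]
        rw [integral_const_mul, integral_exp_mul_poissonMeasure]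
        exact mul_le_mul_of_nonneg_left (hexp _ (by positivity)) (by positivity)
      integral_fst := by
        have h1 : Integrable (fun k => φ k - a) P := hφi.sub (integrable_const _)
        rw [hY, integral_sub h1 (hXi.const_mul _), integral_sub hφi (integrable_const _),
          integral_const_mul, integral_sub_poissonMeasure]
        simp [ha]
      integral_mul := by
        have e : ∀ k : ℕ, Y k * (k - r) = φ k * (k - r) - a * (k - r) -
            b * (((k : ℝ) - r) * (k - r)) := fun k => by rw [hY]; ring
        simp_rw [e]
        have h1 : Integrable (fun k : ℕ => φ k * (k - r) - a * ((k : ℝ) - r)) P :=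
          hφXi.sub (hXi.const_mul _)
        rw [integral_sub h1 (hXXi.const_mul _), integral_sub hφXi (hXi.const_mul _),
          integral_const_mul, integral_const_mul, integral_sub_poissonMeasure,
          integral_sub_mul_sub_poissonMeasure, hb]
        field_simp
        ring }
  exact ⟨Y, g, a, b, fun k => rfl, hmb, hs r hr1 hr2 Y a b (fun k => rfl) hmb.integrable_sq,
    fun u hu => norm_integral_exp_poissonMeasure_le hr1 hu⟩

end Poisson

/-! ### Fourier estimates for the conditioned counts -/

/-- The point probability of a Poisson law at its integral mean is at least of order `m ^ (-1/2)`. -/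
lemma le_exp_neg_mul_pow_div_factorial {m : ℕ} (hm : 0 < m) :
    1 / (2 * Real.sqrt m) ≤ 2 * Real.pi * (Real.exp (-m) * m ^ m / m.factorial) := by
  obtain ⟨k, rfl⟩ := Nat.exists_eq_succ_of_ne_zero hm.ne'
  -- Stirling's sequence decreases from its first term `e / √2`, so `m! ≤ e √m (m/e)^m`.
  have h := Stirling.stirlingSeq'_antitone (Nat.zero_le k)
  simp only [Function.comp_apply] at h
  rw [Nat.succ_eq_add_one, Nat.succ_eq_add_one, zero_add, Stirling.stirlingSeq_one,
    Stirling.stirlingSeq] at h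
  set m := k + 1
  have hm' : (0 : ℝ) < m := by positivity
  have hsq : 0 < Real.sqrt m := Real.sqrt_pos.2 hm'
  rw [div_le_iff₀ (by positivity), Real.sqrt_mul (by norm_num), div_pow, ← Real.exp_nat_mul,
    mul_one] at h
  have h2 : Real.exp 1 / Real.sqrt 2 * (Real.sqrt 2 * Real.sqrt m * ((m : ℝ) ^ m / Real.exp m)) =
      Real.exp 1 * Real.sqrt m * ((m : ℝ) ^ m / Real.exp m) := by
    have : Real.sqrt 2 ≠ 0 := by positivity
    field_simp
  rw [h2] at h
  have he : Real.exp 1 ≤ 3 := by linarith [Real.exp_one_lt_d9]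
  have hpi := Real.pi_gt_three
  have hf : (0 : ℝ) < m.factorial := by positivity
  rw [Real.exp_neg, div_le_iff₀ (by positivity)]
  have hx : 0 < (m : ℝ) ^ m / Real.exp m := by positivity
  have e : 2 * Real.pi * ((Real.exp m)⁻¹ * (m : ℝ) ^ m / m.factorial) * (2 * Real.sqrt m) =
      4 * Real.pi * (Real.sqrt m * ((m : ℝ) ^ m / Real.exp m)) / m.factorial := by
    field_simp
    ring
  rw [e, le_div_iff₀ hf, one_mul]
  refine h.trans ?_
  rw [mul_assoc]
  gcongr
  linarith

/-- Each factor `|u|` is worth `1 / a`. With `y = a|u|`, the bounds `y^j ≤ j! e^y` and `y - y² ≤ 1/2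
- y²/2` leave half of the Gaussian exponent; `√e ≤ 2` and `√(2π) ≤ 3` give the constant. -/
lemma integral_abs_pow_mul_exp_neg_le {a : ℝ} (ha : 0 < a) (j : ℕ) :
    ∫ u in (-Real.pi)..Real.pi, |u| ^ j * Real.exp (-a ^ 2 * u ^ 2) ≤
      6 * j.factorial / a ^ (j + 1) := by
  have hpt : ∀ u : ℝ, |u| ^ j * Real.exp (-a ^ 2 * u ^ 2) ≤
      2 * j.factorial / a ^ j * Real.exp (-(a ^ 2 / 2) * u ^ 2) := by
    intro u
    set y := a * |u| with hy
    have hy0 : 0 ≤ y := by positivity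
    have h1 : y ^ j ≤ j.factorial * Real.exp y := by
      have := Real.pow_div_factorial_le_exp y hy0 j
      rwa [div_le_iff₀ (by positivity), mul_comm] at this
    have hyu : y ^ 2 = a ^ 2 * u ^ 2 := by rw [hy, mul_pow, sq_abs]
    have h2 : Real.exp y * Real.exp (-a ^ 2 * u ^ 2) ≤ 2 * Real.exp (-(a ^ 2 / 2) * u ^ 2) := by
      have h3 : Real.exp (1 / 2) ≤ 2 := by
        have h4 : Real.exp (1 / 2) * Real.exp (1 / 2) = Real.exp 1 := by
          rw [← Real.exp_add]; norm_num
        have := Real.exp_one_lt_d9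
        have := Real.exp_pos (1 / 2)
        nlinarith
      calc Real.exp y * Real.exp (-a ^ 2 * u ^ 2) = Real.exp (y + -a ^ 2 * u ^ 2) :=
            (Real.exp_add _ _).symm
        _ ≤ Real.exp (1 / 2 + -(a ^ 2 / 2) * u ^ 2) := by
            apply Real.exp_le_exp.2
            nlinarith [sq_nonneg (y - 1)]
        _ = Real.exp (1 / 2) * Real.exp (-(a ^ 2 / 2) * u ^ 2) := Real.exp_add _ _
        _ ≤ _ := by gcongr
    have h5 : |u| ^ j = y ^ j / a ^ j := by
      rw [hy, mul_pow]; field_simp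
    calc |u| ^ j * Real.exp (-a ^ 2 * u ^ 2) = y ^ j / a ^ j * Real.exp (-a ^ 2 * u ^ 2) := by
          rw [h5]
      _ ≤ (j.factorial * Real.exp y) / a ^ j * Real.exp (-a ^ 2 * u ^ 2) := by gcongr
      _ = j.factorial / a ^ j * (Real.exp y * Real.exp (-a ^ 2 * u ^ 2)) := by ring
      _ ≤ j.factorial / a ^ j * (2 * Real.exp (-(a ^ 2 / 2) * u ^ 2)) := by gcongr
      _ = _ := by ring
  have hpi : -Real.pi ≤ Real.pi := by linarith [Real.pi_pos]
  have hint : Integrable fun u : ℝ => Real.exp (-(a ^ 2 / 2) * u ^ 2) :=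
    integrable_exp_neg_mul_sq (by positivity)
  have hle : ∫ u in (-Real.pi)..Real.pi, Real.exp (-(a ^ 2 / 2) * u ^ 2) ≤ 3 / a := by
    rw [intervalIntegral.integral_of_le hpi]
    refine (setIntegral_le_integral hint (ae_of_all _ fun u => (Real.exp_pos _).le)).trans ?_
    rw [integral_gaussian]
    apply Real.sqrt_le_iff.2 ⟨by positivity, ?_⟩
    rw [div_pow, div_div_eq_mul_div]
    gcongr
    linarith [Real.pi_lt_d2]
  calc _ ≤ ∫ u in (-Real.pi)..Real.pi,
        2 * j.factorial / a ^ j * Real.exp (-(a ^ 2 / 2) * u ^ 2) := by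
        apply intervalIntegral.integral_mono_on hpi
        · exact Continuous.intervalIntegrable (by fun_prop) _ _
        · exact Continuous.intervalIntegrable (by fun_prop) _ _
        · exact fun u _ => hpt u
    _ ≤ 2 * j.factorial / a ^ j * (3 / a) := by
        rw [intervalIntegral.integral_const_mul]
        gcongr
    _ = _ := by
        rw [pow_succ]; field_simp; ring

namespace Occupancy

open scoped NNReal

/-- The price of conditioning is a factor `√n`, to be repaid by the width `n^{-1/2}` of the integral
over `u`. -/
lemma one_div_le_mul_sqrt {n m : ℕ} {l₁ l₂ : ℝ} (hn : 0 < n) (hl₁ : 0 < l₁) (h1 : l₁ * n ≤ m)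
    (h2 : (m : ℝ) ≤ l₂ * n) :
    1 / (2 * Real.pi * (Real.exp (-m) * m ^ m / m.factorial)) ≤
      2 * Real.sqrt l₂ * Real.sqrt n := by
  have hn' : (0 : ℝ) < n := by exact_mod_cast hn
  have hm' : (0 : ℝ) < m := lt_of_lt_of_le (by positivity) h1
  have hm : 0 < m := by exact_mod_cast hm'
  have h := le_exp_neg_mul_pow_div_factorial hm
  have hl₂ : 0 ≤ l₂ := by
    by_contra! hc
    nlinarith
  have hs : 0 < Real.sqrt m := Real.sqrt_pos.2 hm'
  calc _ ≤ 1 / (1 / (2 * Real.sqrt m)) := one_div_le_one_div_of_le (by positivity) h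
    _ = 2 * Real.sqrt m := one_div_one_div _
    _ ≤ 2 * Real.sqrt (l₂ * n) := by gcongr
    _ = _ := by rw [Real.sqrt_mul hl₂]; ring

/-- One formula for all uses: `S = univ` gives the characteristic function, `S = ∅` the
normalization, and sets of one or two urns give the moments. -/
lemma integral_prod_finset_poisson {n : ℕ} [NeZero n] (m : ℕ) (r : ℝ≥0) (hr : (r : ℝ) * n = m)
    (f : ℕ → ℂ) (hf : Integrable f (poissonMeasure r)) (S : Finset (Fin n)) :
    ∫ u in (-Real.pi)..Real.pi,
      (∫ k, f k * Complex.exp (u * ((k - r : ℝ) : ℂ) * Complex.I) ∂(poissonMeasure r)) ^ S.card *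
      (∫ k : ℕ, Complex.exp (u * ((k - r : ℝ) : ℂ) * Complex.I) ∂(poissonMeasure r)) ^
        (n - S.card) =
      ((2 * Real.pi * (Real.exp (-m) * m ^ m / m.factorial) : ℝ) : ℂ) *
        ∫ ω, ∏ i ∈ S, f (count i ω) ∂(urnLaw m fun _ : Fin n => 1 / (n : ℝ)) := by
  classical
  have h := integral_prod_poisson m r hr (fun i => if i ∈ S then f else fun _ => 1) (fun i => by
    split_ifs
    · exact hf
    · exact integrable_const _)
  have e1 : ∀ (u : ℝ) (i : Fin n), ∫ k : ℕ, (if i ∈ S then f else fun _ => 1) k *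
      Complex.exp (u * ((k - r : ℝ) : ℂ) * Complex.I) ∂(poissonMeasure r) = if i ∈ S then
      ∫ k, f k * Complex.exp (u * ((k - r : ℝ) : ℂ) * Complex.I) ∂(poissonMeasure r) else
      ∫ k : ℕ, Complex.exp (u * ((k - r : ℝ) : ℂ) * Complex.I) ∂(poissonMeasure r) := by
    intro u i
    split_ifs <;> simp
  have e2 : ∀ ω : Fin m → Fin n, ∏ i, (if i ∈ S then f else fun _ => 1) (count i ω) =
      ∏ i ∈ S, f (count i ω) := by
    intro ω
    rw [← Finset.prod_filter_mul_prod_filter_not Finset.univ (· ∈ S)]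
    rw [Finset.filter_mem_eq_inter, Finset.univ_inter,
      Finset.prod_congr rfl (g := fun i => f (count i ω)) (fun i hi => by rw [if_pos hi]),
      Finset.prod_eq_one (s := Finset.univ.filter fun i => i ∉ S)
        (fun i hi => by rw [if_neg (Finset.mem_filter.1 hi).2]), mul_one]
  simp_rw [e1, e2] at h
  rw [← h]
  congr 1; ext u
  rw [Finset.prod_ite, Finset.prod_const, Finset.prod_const, Finset.filter_mem_eq_inter,
    Finset.univ_inter, Finset.filter_not, Finset.filter_mem_eq_inter, Finset.univ_inter,
    Finset.card_sdiff_of_subset (Finset.subset_univ _), Finset.card_univ, Fintype.card_fin]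

/-- If the Fourier transform of `f` vanishes to order `p` at the origin, then the mixed moments of
`f` at `j` distinct urns are of order `n ^ (- p * j / 2)`. -/
lemma exists_norm_integral_prod_le {κ l₁ l₂ C : ℝ} (hκ : 0 < κ) (hl₁ : 0 < l₁) (hC : 0 ≤ C)
    (p j : ℕ) : ∃ D : ℝ, 0 ≤ D ∧ ∀ (n m : ℕ) [NeZero n] (r : ℝ≥0) (_ : (r : ℝ) * n = m)
      (_ : l₁ * n ≤ m) (_ : (m : ℝ) ≤ l₂ * n) (_ : 2 * j ≤ n)
      (_ : ∀ u : ℝ, |u| ≤ Real.pi →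
        ‖∫ k : ℕ, Complex.exp (u * ((k - r : ℝ) : ℂ) * Complex.I) ∂(poissonMeasure r)‖ ≤
          Real.exp (-κ * u ^ 2))
      (f : ℕ → ℂ) (_ : Integrable f (poissonMeasure r))
      (_ : ∀ u : ℝ, ‖∫ k, f k * Complex.exp (u * ((k - r : ℝ) : ℂ) * Complex.I)
        ∂(poissonMeasure r)‖ ≤ C * |u| ^ p)
      (S : Finset (Fin n)) (_ : S.card = j),
      ‖∫ ω, ∏ i ∈ S, f (count i ω) ∂(urnLaw m fun _ : Fin n => 1 / (n : ℝ))‖ ≤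
        D / Real.sqrt n ^ (p * j) := by
  refine ⟨2 * Real.sqrt l₂ * (C ^ j * (6 * (p * j).factorial)) / Real.sqrt (κ / 2) ^ (p * j + 1),
    by positivity, ?_⟩
  intro n m _ r hr h1 h2 hjn hB f hf hfu S hS
  have hn : 0 < n := Nat.pos_of_ne_zero (NeZero.ne n)
  have hn' : (0 : ℝ) < n := by exact_mod_cast hn
  have hid := integral_prod_finset_poisson m r hr f hf S
  have hI := one_div_le_mul_sqrt hn hl₁ h1 h2
  have hm' : (0 : ℝ) < m := lt_of_lt_of_le (by positivity) h1
  have hI0 : 0 < 2 * Real.pi * (Real.exp (-m) * m ^ m / m.factorial) := by positivity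
  set I₀ := 2 * Real.pi * (Real.exp (-m) * m ^ m / m.factorial)
  set a := Real.sqrt (κ / 2) * Real.sqrt n with ha
  have ha0 : 0 < a := by positivity
  have ha2 : a ^ 2 = κ / 2 * n := by
    rw [ha, mul_pow, Real.sq_sqrt (by positivity), Real.sq_sqrt hn'.le]
  have hpi : -Real.pi ≤ Real.pi := by linarith [Real.pi_pos]
  have hbound : ‖∫ u in (-Real.pi)..Real.pi,
      (∫ k, f k * Complex.exp (u * ((k - r : ℝ) : ℂ) * Complex.I) ∂(poissonMeasure r)) ^ S.card *
      (∫ k : ℕ, Complex.exp (u * ((k - r : ℝ) : ℂ) * Complex.I) ∂(poissonMeasure r)) ^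
        (n - S.card)‖ ≤ C ^ j * (6 * (p * j).factorial / a ^ (p * j + 1)) := by
    refine (intervalIntegral.norm_integral_le_of_norm_le (g := fun u => C ^ j *
      (|u| ^ (p * j) * Real.exp (-a ^ 2 * u ^ 2))) hpi (ae_of_all _ fun u hu => ?_)
      (Continuous.intervalIntegrable (by fun_prop) _ _)).trans ?_
    · rw [norm_mul, norm_pow, norm_pow, hS]
      have hu' : |u| ≤ Real.pi := abs_le.2 ⟨hu.1.le, hu.2⟩
      calc _ ≤ (C * |u| ^ p) ^ j * Real.exp (-κ * u ^ 2) ^ (n - j) := by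
            gcongr
            · exact hfu u
            · exact hB u hu'
        _ ≤ (C * |u| ^ p) ^ j * Real.exp (-a ^ 2 * u ^ 2) := by
            gcongr
            rw [← Real.exp_nat_mul, ha2]
            apply Real.exp_le_exp.2
            -- The `n - j` urns outside `S` still provide half of the Gaussian decay.
            have hnj : (n : ℝ) / 2 ≤ ((n - j : ℕ) : ℝ) := by
              rw [Nat.cast_sub (by omega)]
              have : (2 * j : ℝ) ≤ n := by exact_mod_cast hjn
              linarith
            have h3 : 0 ≤ κ * u ^ 2 := by positivity
            nlinarith
        _ = _ := by rw [mul_pow, ← pow_mul, mul_assoc]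
    · rw [intervalIntegral.integral_const_mul]
      gcongr
      exact integral_abs_pow_mul_exp_neg_le ha0 _
  rw [hid, norm_mul, Complex.norm_real, Real.norm_eq_abs, abs_of_pos hI0] at hbound
  set x := ‖∫ ω, ∏ i ∈ S, f (count i ω) ∂(urnLaw m fun _ : Fin n => 1 / (n : ℝ))‖
  calc x = 1 / I₀ * (I₀ * x) := by field_simp
    _ ≤ (2 * Real.sqrt l₂ * Real.sqrt n) * (C ^ j * (6 * (p * j).factorial / a ^ (p * j + 1))) := by
      gcongr
    -- The factor `√n` from conditioning cancels one of the `p * j + 1` powers of `√n` in `a`.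
    _ = _ := by
      rw [ha, mul_pow, pow_succ (Real.sqrt n)]
      field_simp

/-- Gaussian approximation of the characteristic function of a sum over urns. -/
lemma exists_norm_charFun_sub_le {κ s₀ M l₁ l₂ : ℝ} (hκ : 0 < κ) (hs₀ : 0 < s₀) (hM : 0 < M)
    (hl₁ : 0 < l₁) : ∃ ε c D : ℝ, 0 < ε ∧ 0 < c ∧ 0 ≤ D ∧
      ∀ (n m : ℕ) [NeZero n] (r : ℝ≥0) (_ : (r : ℝ) * n = m)
      (_ : l₁ * n ≤ m) (_ : (m : ℝ) ≤ l₂ * n) (_ : 2 ≤ n)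
      (_ : ∀ u : ℝ, |u| ≤ Real.pi →
        ‖∫ k : ℕ, Complex.exp (u * ((k - r : ℝ) : ℂ) * Complex.I) ∂(poissonMeasure r)‖ ≤
          Real.exp (-κ * u ^ 2))
      (Y g : ℕ → ℝ) (_ : MomentBound (poissonMeasure r) Y (fun k => (k : ℝ) - r) g M)
      (_ : s₀ ≤ ∫ k, Y k ^ 2 ∂(poissonMeasure r)) (t : ℝ) (_ : |t| ≤ ε),
      ‖∫ ω, Complex.exp (t * ((∑ i, Y (count i ω) : ℝ) : ℂ) * Complex.I)
          ∂(urnLaw m fun _ : Fin n => 1 / (n : ℝ)) -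
        (Real.exp (-(n * (t ^ 2 * (∫ k, Y k ^ 2 ∂(poissonMeasure r)) / 2))) : ℂ)‖ ≤
      D * (|t| * (1 + n * t ^ 2) * Real.exp (-c * (n * t ^ 2))) := by
  obtain ⟨ε, c, K, hε, hε1, hc, hK, H⟩ := exists_charFun_pow_sub_le hκ hs₀ hM
  set b := Real.sqrt (c / 2) with hb
  have hb0 : 0 < b := by positivity
  refine ⟨ε, c / 2, 2 * Real.sqrt l₂ * K * (6 / b + 12 / b ^ 3), hε, by positivity,
    by positivity, ?_⟩
  intro n m _ r hr h1 h2 hn2 hB Y g h hs t ht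
  have hn : 0 < n := Nat.pos_of_ne_zero (NeZero.ne n)
  have hn' : (0 : ℝ) < n := by exact_mod_cast hn
  have hI := one_div_le_mul_sqrt hn hl₁ h1 h2
  have hm' : (0 : ℝ) < m := lt_of_lt_of_le (by positivity) h1
  have hI0 : 0 < 2 * Real.pi * (Real.exp (-m) * m ^ m / m.factorial) := by positivity
  have hH := H (poissonMeasure r) Y _ g h hs hB n t
  have id1 := integral_prod_finset_poisson m r hr (fun k => Complex.exp (t * Y k * Complex.I))
    (Integrable.mono' (integrable_const 1) .of_discrete
      (ae_of_all _ fun k => (norm_exp_ofReal_mul_ofReal_mul_I _ _).le)) Finset.univ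
  have id2 := integral_prod_finset_poisson m r hr (fun _ => 1) (integrable_const _) ∅
  simp only [Finset.card_univ, Fintype.card_fin, Nat.sub_self, pow_zero, mul_one,
    ← Complex.exp_sum] at id1
  simp only [Finset.card_empty, pow_zero, one_mul, Nat.sub_zero, Finset.prod_empty,
    integral_const, probReal_univ, one_smul, mul_one] at id2
  set s := ∫ k, Y k ^ 2 ∂(poissonMeasure r)
  set I₀ := 2 * Real.pi * (Real.exp (-m) * m ^ m / m.factorial)
  set a := b * Real.sqrt n with ha
  have ha0 : 0 < a := by positivity
  have ha2 : a ^ 2 = c / 2 * n := by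
    rw [ha, mul_pow, Real.sq_sqrt (by positivity), Real.sq_sqrt hn'.le]
  have hpi : -Real.pi ≤ Real.pi := by linarith [Real.pi_pos]
  have e1 : ∀ ω : Fin m → Fin n, Complex.exp (t * ((∑ i, Y (count i ω) : ℝ) : ℂ) * Complex.I) =
      Complex.exp (∑ i, t * (Y (count i ω) : ℂ) * Complex.I) := by
    intro ω
    rw [← Finset.sum_mul, ← Finset.mul_sum]
    push_cast
    rfl
  simp_rw [e1]
  set Z := ∫ ω, Complex.exp (∑ i, t * (Y (count i ω) : ℂ) * Complex.I)
    ∂(urnLaw m fun _ : Fin n => 1 / (n : ℝ))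
  have hcA : Continuous fun u : ℝ => ∫ k : ℕ, Complex.exp (t * Y k * Complex.I) *
      Complex.exp (u * ((k - r : ℝ) : ℂ) * Complex.I) ∂(poissonMeasure r) := by
    refine continuous_of_dominated (bound := fun _ => 1) (fun u => .of_discrete) (fun u =>
      ae_of_all _ fun k => ?_) (integrable_const _) (ae_of_all _ fun k => by fun_prop)
    rw [norm_mul, norm_exp_ofReal_mul_ofReal_mul_I, norm_exp_ofReal_mul_ofReal_mul_I, one_mul]
  have hcB : Continuous fun u : ℝ => ∫ k : ℕ,
      Complex.exp (u * ((k - r : ℝ) : ℂ) * Complex.I) ∂(poissonMeasure r) := by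
    refine continuous_of_dominated (bound := fun _ => 1) (fun u => .of_discrete) (fun u =>
      ae_of_all _ fun k => ?_) (integrable_const _) (ae_of_all _ fun k => by fun_prop)
    rw [norm_exp_ofReal_mul_ofReal_mul_I]
  set E := Real.exp (-(n * (t ^ 2 * s / 2))) with hE
  -- The factor `E` does not depend on `u`, so the normalization identity writes `I₀ E` as an
  -- integral too, and the two integrands can be compared pointwise.
  have e2 : (I₀ : ℂ) * (Z - E) = ∫ u in (-Real.pi)..Real.pi,
      ((∫ k : ℕ, Complex.exp (t * Y k * Complex.I) *
        Complex.exp (u * ((k - r : ℝ) : ℂ) * Complex.I) ∂(poissonMeasure r)) ^ n -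
      (E : ℂ) * (∫ k : ℕ, Complex.exp (u * ((k - r : ℝ) : ℂ) * Complex.I)
        ∂(poissonMeasure r)) ^ n) := by
    rw [intervalIntegral.integral_sub, intervalIntegral.integral_const_mul, id1, id2]
    · ring
    · exact (hcA.pow n).intervalIntegrable _ _
    · exact (continuous_const.mul (hcB.pow n)).intervalIntegrable _ _
  have hbound : ‖(I₀ : ℂ) * (Z - E)‖ ≤ n * K * |t| * Real.exp (-(c / 2) * (n * t ^ 2)) *
      (t ^ 2 * (6 / a) + 12 / a ^ 3) := by
    rw [e2]
    refine (intervalIntegral.norm_integral_le_of_norm_le (g := fun u =>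
      n * K * |t| * Real.exp (-(c / 2) * (n * t ^ 2)) *
        (t ^ 2 * (|u| ^ 0 * Real.exp (-a ^ 2 * u ^ 2)) + |u| ^ 2 * Real.exp (-a ^ 2 * u ^ 2)))
      hpi (ae_of_all _ fun u hu => ?_) (Continuous.intervalIntegrable (by fun_prop) _ _)).trans ?_
    · have hu' : |u| ≤ Real.pi := abs_le.2 ⟨hu.1.le, hu.2⟩
      refine (hH u ht hu').trans ?_
      have h3 : Real.exp (-c * (t ^ 2 + u ^ 2)) ^ (n - 1) ≤
          Real.exp (-(c / 2) * (n * t ^ 2)) * Real.exp (-a ^ 2 * u ^ 2) := by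
        rw [← Real.exp_nat_mul, ← Real.exp_add, ha2]
        apply Real.exp_le_exp.2
        have hnj : (n : ℝ) / 2 ≤ ((n - 1 : ℕ) : ℝ) := by
          rw [Nat.cast_sub (by omega)]
          have : (2 : ℝ) ≤ n := by exact_mod_cast hn2
          push_cast
          linarith
        have h3 : 0 ≤ c * (t ^ 2 + u ^ 2) := by positivity
        nlinarith
      calc _ ≤ n * (K * (|t| * (t ^ 2 + u ^ 2))) *
            (Real.exp (-(c / 2) * (n * t ^ 2)) * Real.exp (-a ^ 2 * u ^ 2)) := by gcongr
        _ = _ := by rw [pow_zero, sq_abs]; ring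
    · rw [intervalIntegral.integral_const_mul, intervalIntegral.integral_add
        (Continuous.intervalIntegrable (by fun_prop) _ _)
        (Continuous.intervalIntegrable (by fun_prop) _ _), intervalIntegral.integral_const_mul]
      have g0 := integral_abs_pow_mul_exp_neg_le ha0 0
      have g2 := integral_abs_pow_mul_exp_neg_le ha0 2
      norm_num [Nat.factorial] at g0 g2
      simp only [pow_zero, one_mul, sq_abs, neg_mul] at g0 g2 ⊢
      gcongr
  rw [norm_mul, Complex.norm_real, Real.norm_eq_abs, abs_of_pos hI0] at hbound
  have hsn : Real.sqrt n ^ 2 = n := Real.sq_sqrt hn'.le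
  have hsn0 : 0 < Real.sqrt n := Real.sqrt_pos.2 hn'
  calc ‖Z - E‖ = 1 / I₀ * (I₀ * ‖Z - E‖) := by field_simp
    _ ≤ (2 * Real.sqrt l₂ * Real.sqrt n) * (n * K * |t| * Real.exp (-(c / 2) * (n * t ^ 2)) *
      (t ^ 2 * (6 / a) + 12 / a ^ 3)) := by gcongr
    -- With `a = b √n`, the product of `n √n` and `t² / a` is of order `n t²`, while `n √n / a³` is
    -- bounded.
    _ = 2 * Real.sqrt l₂ * K * (n * t ^ 2 * (6 / b) + 12 / b ^ 3) *
        (|t| * Real.exp (-(c / 2) * (n * t ^ 2))) := by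
      rw [ha]
      generalize Real.sqrt n = y at hsn hsn0 ⊢
      rw [← hsn]
      field_simp
    _ ≤ 2 * Real.sqrt l₂ * K * ((6 / b + 12 / b ^ 3) * (1 + n * t ^ 2)) *
        (|t| * Real.exp (-(c / 2) * (n * t ^ 2))) := by
      gcongr
      have : 0 ≤ (n : ℝ) * t ^ 2 := by positivity
      have h6 : 0 < 6 / b := by positivity
      have h7 : 0 < 12 / b ^ 3 := by positivity
      nlinarith
    _ = _ := by ring

end Occupancy

/-! ### Moments of the residual sum -/

namespace Occupancy

open scoped NNReal

/-- Mean, second moment and characteristic function of the additive functional, up to a shift. -/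
theorem exists_residual_sum_estimates {φ : ℕ → ℝ} {K : ℝ} (hK : 0 < K)
    (hgrowth : ∀ x : ℕ, |φ x| ≤ K * Real.exp (K * (x : ℝ)))
    (h : ¬ ∃ a b : ℝ, ∀ x : ℕ, φ x = a + b * (x : ℝ)) {l₁ l₂ : ℝ} (hl₁ : 0 < l₁) :
    ∃ s₀ M ε c C : ℝ, 0 < s₀ ∧ 0 < M ∧ 0 < ε ∧ 0 < c ∧ 0 < C ∧
      ∀ (n m : ℕ) [NeZero n] (_ : l₁ * n ≤ m) (_ : (m : ℝ) ≤ l₂ * n) (_ : 4 ≤ n),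
      ∃ (U : (Fin m → Fin n) → ℝ) (d s : ℝ), (∀ ω, V m (fun _ => φ) ω = d + U ω) ∧
        s₀ ≤ s ∧ s ≤ M ∧
        |∫ ω, U ω ∂(urnLaw m fun _ : Fin n => 1 / (n : ℝ))| ≤ C ∧
        |∫ ω, U ω ^ 2 ∂(urnLaw m fun _ : Fin n => 1 / (n : ℝ)) - n * s| ≤ C * Real.sqrt n ∧
        ∀ t : ℝ, |t| ≤ ε → ‖∫ ω, Complex.exp (t * (U ω : ℂ) * Complex.I)
          ∂(urnLaw m fun _ : Fin n => 1 / (n : ℝ)) - (Real.exp (-(n * (t ^ 2 * s / 2))) : ℂ)‖ ≤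
          C * (|t| * (1 + n * t ^ 2) * Real.exp (-c * (n * t ^ 2))) := by
  obtain ⟨s₀, M, κ, hs₀, hM, hκ, hres⟩ := exists_poisson_residual hK hgrowth h (l₂ := l₂) hl₁
  obtain ⟨ε, c, D₀, hε, hc, hD₀, hcf⟩ :=
    exists_norm_charFun_sub_le (l₂ := l₂) hκ hs₀ hM hl₁
  -- Orders for the three moments: `E Y(ξ_i) = O(1/n)` from `p = 2`, `j = 1`; `E Y(ξ_i) Y(ξ_j) =
  -- O(1/n²)` from `p = 2`, `j = 2`; `E Y(ξ_i)² - s = O(n^{-1/2})` from `p = 1`, `j = 1`.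
  obtain ⟨D₁, hD₁, hm1⟩ := exists_norm_integral_prod_le (l₂ := l₂) hκ hl₁
    (show 0 ≤ 2 * M by positivity) 2 1
  obtain ⟨D₂, hD₂, hm2⟩ := exists_norm_integral_prod_le (l₂ := l₂) hκ hl₁
    (show 0 ≤ 2 * M by positivity) 2 2
  obtain ⟨D₃, hD₃, hm3⟩ := exists_norm_integral_prod_le (l₂ := l₂) hκ hl₁
    (show 0 ≤ (1 + M) * M by positivity) 1 1
  refine ⟨s₀, M, ε, c, 1 + D₀ + D₁ + D₂ + D₃, hs₀, hM, hε, hc, by positivity, ?_⟩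
  intro n m _ h1 h2 hn4
  have hn : 0 < n := Nat.pos_of_ne_zero (NeZero.ne n)
  have hn' : (0 : ℝ) < n := by exact_mod_cast hn
  have hn1 : (1 : ℝ) ≤ n := by exact_mod_cast hn
  obtain ⟨r, hr⟩ : ∃ r : ℝ≥0, (r : ℝ) = m / n := ⟨⟨m / n, by positivity⟩, rfl⟩
  have hrn : (r : ℝ) * n = m := by rw [hr]; field_simp
  obtain ⟨Y, g, a, b, hY, hmb, hs, hB⟩ := hres r (by rw [hr, le_div_iff₀ hn']; exact h1)
    (by rw [hr, div_le_iff₀ hn']; exact h2)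
  set Q := urnLaw m fun _ : Fin n => 1 / (n : ℝ) with hQ
  set s := ∫ k, Y k ^ 2 ∂(poissonMeasure r) with hsdef
  have hint : ∀ f : (Fin m → Fin n) → ℝ, Integrable f Q := fun f => .of_finite
  have hsn : Real.sqrt n ^ 2 = n := Real.sq_sqrt hn'.le
  have hsn1 : 1 ≤ Real.sqrt n := Real.one_le_sqrt.2 hn1
  have hsn0 : 0 < Real.sqrt n := by linarith
  have hYi : Integrable (fun k => (Y k : ℂ)) (poissonMeasure r) := hmb.integrable_fst.ofReal
  have hYF : ∀ u : ℝ, ‖∫ k, (Y k : ℂ) * Complex.exp (u * ((k - r : ℝ) : ℂ) * Complex.I)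
      ∂(poissonMeasure r)‖ ≤ 2 * M * |u| ^ 2 := fun u => by
    refine (hmb.norm_integral_mul_exp_le u).trans (le_of_eq ?_)
    rw [sq_abs]; ring
  have hYi2 : Integrable (fun k => ((Y k ^ 2 - s : ℝ) : ℂ)) (poissonMeasure r) := by
    have : Integrable (fun k => Y k ^ 2 - s) (poissonMeasure r) :=
      hmb.integrable_sq.sub (integrable_const _)
    exact this.ofReal
  have hYF2 : ∀ u : ℝ, ‖∫ k, ((Y k ^ 2 - s : ℝ) : ℂ) *
      Complex.exp (u * ((k - r : ℝ) : ℂ) * Complex.I) ∂(poissonMeasure r)‖ ≤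
        (1 + M) * M * |u| ^ 1 := fun u => by
    refine (hmb.norm_integral_sq_sub_mul_exp_le u).trans (le_of_eq ?_)
    rw [pow_one]; ring
  have b1 : ∀ i, |∫ ω, Y (count i ω) ∂Q| ≤ D₁ / n := by
    intro i
    have := hm1 n m r hrn h1 h2 (by omega) hB (fun k => (Y k : ℂ)) hYi hYF {i} (by simp)
    simp only [Finset.prod_singleton] at this
    rw [integral_complex_ofReal, Complex.norm_real, Real.norm_eq_abs] at this
    rwa [mul_one, hsn] at this
  have b2 : ∀ i j, i ≠ j → |∫ ω, Y (count i ω) * Y (count j ω) ∂Q| ≤ D₂ / (n * n) := by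
    intro i j hij
    have := hm2 n m r hrn h1 h2 (by omega) hB (fun k => (Y k : ℂ)) hYi hYF {i, j}
      (Finset.card_pair hij)
    simp only [Finset.prod_pair hij, ← Complex.ofReal_mul] at this
    rw [integral_complex_ofReal, Complex.norm_real, Real.norm_eq_abs] at this
    rwa [pow_mul, hsn, sq] at this
  have b3 : ∀ i, |∫ ω, (Y (count i ω) ^ 2 - s) ∂Q| ≤ D₃ / Real.sqrt n := by
    intro i
    have := hm3 n m r hrn h1 h2 (by omega) hB (fun k => ((Y k ^ 2 - s : ℝ) : ℂ)) hYi2 hYF2 {i}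
      (by simp)
    simp only [Finset.prod_singleton] at this
    rw [integral_complex_ofReal, Complex.norm_real, Real.norm_eq_abs] at this
    rwa [mul_one, pow_one] at this
  -- The regression term disappears because the counts sum to `m = r n`, leaving only the constant
  -- `n a`.
  refine ⟨fun ω => ∑ i, Y (count i ω), n * a, s, ?_, hs, hmb.integral_sq_le, ?_, ?_, ?_⟩
  · intro ω
    have hsum : ∑ i, ((count i ω : ℕ) : ℝ) = m := by exact_mod_cast sum_count ω
    simp_rw [V, hY]
    rw [Finset.sum_sub_distrib, Finset.sum_sub_distrib, ← Finset.mul_sum, Finset.sum_sub_distrib,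
      hsum, ← hrn]
    simp only [Finset.sum_const, Finset.card_univ, Fintype.card_fin, nsmul_eq_mul]
    ring
  · rw [integral_finsetSum _ fun i _ => hint _]
    refine (Finset.abs_sum_le_sum_abs _ _).trans ((Finset.sum_le_sum fun i _ => b1 i).trans ?_)
    simp only [Finset.sum_const, Finset.card_univ, Fintype.card_fin, nsmul_eq_mul]
    rw [mul_div_cancel₀ _ hn'.ne']
    linarith
  · have e : ∀ ω : Fin m → Fin n, (∑ i, Y (count i ω)) ^ 2 = (∑ i, (Y (count i ω) ^ 2 - s)) +
        n * s + ∑ i, ∑ j ∈ Finset.univ.erase i, Y (count i ω) * Y (count j ω) := by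
      intro ω
      rw [sq, Finset.sum_mul_sum, Finset.sum_sub_distrib]
      simp only [Finset.sum_const, Finset.card_univ, Fintype.card_fin, nsmul_eq_mul]
      rw [sub_add_cancel, ← Finset.sum_add_distrib]
      refine Finset.sum_congr rfl fun i _ => ?_
      rw [← Finset.add_sum_erase _ _ (Finset.mem_univ i), sq]
    simp_rw [e]
    rw [integral_add (hint _) (hint _), integral_add (hint _) (hint _),
      integral_finsetSum _ fun i _ => hint _, integral_finsetSum _ fun i _ => hint _]
    simp only [integral_const, probReal_univ, one_smul]
    have e2 : |∑ i, ∫ ω, (Y (count i ω) ^ 2 - s) ∂Q| ≤ D₃ * Real.sqrt n := by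
      refine (Finset.abs_sum_le_sum_abs _ _).trans ((Finset.sum_le_sum fun i _ => b3 i).trans ?_)
      simp only [Finset.sum_const, Finset.card_univ, Fintype.card_fin, nsmul_eq_mul]
      apply le_of_eq
      nth_rewrite 1 [← hsn]
      field_simp
    have e3 : |∑ i, ∫ ω, ∑ j ∈ Finset.univ.erase i, Y (count i ω) * Y (count j ω) ∂Q| ≤ D₂ := by
      refine (Finset.abs_sum_le_sum_abs _ _).trans ?_
      have : ∀ i : Fin n, |∫ ω, ∑ j ∈ Finset.univ.erase i, Y (count i ω) * Y (count j ω) ∂Q| ≤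
          D₂ / n := by
        intro i
        rw [integral_finsetSum _ fun i _ => hint _]
        refine (Finset.abs_sum_le_sum_abs _ _).trans ((Finset.sum_le_sum fun j hj =>
          b2 i j (Finset.ne_of_mem_erase hj).symm).trans ?_)
        rw [Finset.sum_const, nsmul_eq_mul]
        have hcard : ((Finset.univ.erase i).card : ℝ) ≤ n := by
          have := Finset.card_erase_le (s := (Finset.univ : Finset (Fin n))) (a := i)
          rw [Finset.card_univ, Fintype.card_fin] at this
          exact_mod_cast this
        calc _ ≤ (n : ℝ) * (D₂ / (n * n)) := by gcongr
          _ = _ := by field_simp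
      refine (Finset.sum_le_sum fun i _ => this i).trans ?_
      simp only [Finset.sum_const, Finset.card_univ, Fintype.card_fin, nsmul_eq_mul]
      rw [mul_div_cancel₀ _ hn'.ne']
    have e4 : D₂ ≤ D₂ * Real.sqrt n := le_mul_of_one_le_right hD₂ hsn1
    have e5 : 0 ≤ (1 + D₀ + D₁) * Real.sqrt n := by positivity
    rw [abs_le] at e2 e3 ⊢
    constructor <;> linarith [e2.1, e2.2, e3.1, e3.2]
  · intro t ht
    refine (hcf n m r hrn h1 h2 (by omega) hB Y g hmb hs t ht).trans ?_
    gcongr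
    linarith

end Occupancy

/-! ### Comparison with the normal law and standardization -/

lemma gaussianReal_real_Iic_sub_le {x y : ℝ} (hxy : x ≤ y) :
    (gaussianReal 0 1).real (Set.Iic y) - (gaussianReal 0 1).real (Set.Iic x) ≤ y - x := by
  rw [← measureReal_sdiff (Set.Iic_subset_Iic.2 hxy) measurableSet_Iic, Set.Iic_sdiff_Iic,
    measureReal_def]
  apply ENNReal.toReal_le_of_le_ofReal (by linarith)
  rw [gaussianReal_apply 0 one_ne_zero]
  calc ∫⁻ z in Set.Ioc x y, gaussianPDF 0 1 z ≤ ∫⁻ _ in Set.Ioc x y, 1 := by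
        refine lintegral_mono fun z => ?_
        rw [gaussianPDF, gaussianPDFReal]
        refine ENNReal.ofReal_le_one.2 ?_
        have h1 : (1 : ℝ) ≤ Real.sqrt (2 * Real.pi * (1 : NNReal)) := by
          apply Real.one_le_sqrt.2
          have := Real.pi_gt_three
          push_cast
          linarith
        refine mul_le_one₀ (inv_le_one_of_one_le₀ h1) (Real.exp_pos _).le ?_
        apply Real.exp_le_one_iff.2
        push_cast
        have := sq_nonneg (z - 0)
        rw [neg_div]
        linarith [div_nonneg this (show (0 : ℝ) ≤ 2 * 1 by norm_num)]
    _ = ENNReal.ofReal (y - x) := by simp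

/-- Esseen's inequality for the distance to the standard normal law. -/
theorem exists_kolmogorovDist_gaussian_le : ∃ C : ℝ, 0 < C ∧ ∀ (μ : Measure ℝ)
    [IsProbabilityMeasure μ] (_ : Integrable id μ) (T A c : ℝ) (_ : 0 < T) (_ : 0 ≤ A) (_ : 0 < c)
    (_ : ∀ t : ℝ, |t| ≤ T → ‖charFun μ t - Complex.exp (-(t : ℂ) ^ 2 / 2)‖ ≤
      A * (|t| * Real.exp (-c * t ^ 2))),
    kolmogorovDist μ (gaussianReal 0 1) ≤ C * (1 / T + A * Real.sqrt (Real.pi / c)) := by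
  obtain ⟨C, hC, H⟩ := esseen_smoothing
  refine ⟨C, hC, ?_⟩
  intro μ _ hμ T A c hT hA hc hcf
  rw [kolmogorovDist]
  refine Real.iSup_le (fun x => ?_) (by positivity)
  have hmT : Measurable fun x : ℝ => T * x := by fun_prop
  have hp1 : IsProbabilityMeasure (μ.map fun x => T * x) :=
    Measure.isProbabilityMeasure_map hmT.aemeasurable
  have hp2 : IsProbabilityMeasure ((gaussianReal 0 1).map fun x => T * x) :=
    Measure.isProbabilityMeasure_map hmT.aemeasurable
  have hpre : ∀ y, (fun x : ℝ => T * x) ⁻¹' Set.Iic y = Set.Iic (y / T) := by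
    intro y; ext z
    simp [le_div_iff₀ hT, mul_comm]
  have hIic : ∀ (ρ : Measure ℝ) (y : ℝ), (ρ.map fun x => T * x).real (Set.Iic y) =
      ρ.real (Set.Iic (y / T)) := by
    intro ρ y
    rw [map_measureReal_apply hmT measurableSet_Iic, hpre]
  have hi : ∀ ρ : Measure ℝ, Integrable id ρ → Integrable id (ρ.map fun x => T * x) := by
    intro ρ hρ
    rw [integrable_map_measure aestronglyMeasurable_id hmT.aemeasurable]
    exact hρ.const_mul T
  have hgi : Integrable id (gaussianReal 0 1) :=
    (memLp_id_gaussianReal (μ := 0) (v := 1) 1).integrable (by norm_num)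
  -- Dilating by `T` moves the frequency window `[0, T]` to `[0, 1]` and makes the Gaussian
  -- distribution function `1/T`-Lipschitz.
  have key := H (μ.map fun x => T * x) ((gaussianReal 0 1).map fun x => T * x) (hi _ hμ)
    (hi _ hgi) (1 / T) (by positivity) (fun y z hyz => by
      rw [hIic, hIic]
      refine (gaussianReal_real_Iic_sub_le (by gcongr)).trans (le_of_eq ?_)
      ring) (fun t => A * (T * Real.exp (-(c * T ^ 2) * t ^ 2)))
    (Continuous.intervalIntegrable (by fun_prop) _ _) (fun t ht0 ht1 => by
      rw [charFun_map_mul, charFun_map_mul, charFun_gaussianReal]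
      have h1 : |T * t| ≤ T := by
        rw [abs_of_nonneg (by positivity)]
        exact mul_le_of_le_one_right hT.le ht1
      have h2 := hcf (T * t) h1
      rw [abs_of_nonneg (by positivity)] at h2
      have e : Complex.exp (((T * t : ℝ) : ℂ) * ((0 : ℝ) : ℂ) * Complex.I -
          ((1 : NNReal) : ℂ) * ((T * t : ℝ) : ℂ) ^ 2 / 2) =
          Complex.exp (-((T * t : ℝ) : ℂ) ^ 2 / 2) := by
        congr 1
        simp
        ring
      rw [e]
      refine h2.trans (le_of_eq ?_)
      rw [show -c * (T * t) ^ 2 = -(c * T ^ 2) * t ^ 2 by ring]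
      ring) (T * x)
  rw [hIic, hIic, mul_div_cancel_left₀ _ hT.ne'] at key
  refine key.trans ?_
  gcongr
  rw [intervalIntegral.integral_const_mul, intervalIntegral.integral_const_mul]
  gcongr
  have hg : ∫ t in (0 : ℝ)..1, Real.exp (-(c * T ^ 2) * t ^ 2) ≤ Real.sqrt (Real.pi / (c * T ^ 2)) := by
    rw [← integral_gaussian, intervalIntegral.integral_of_le zero_le_one]
    exact setIntegral_le_integral (integrable_exp_neg_mul_sq (by positivity))
      (ae_of_all _ fun u => (Real.exp_pos _).le)
  calc _ ≤ T * Real.sqrt (Real.pi / (c * T ^ 2)) := by gcongr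
    _ = Real.sqrt (Real.pi / c) := by
      rw [← div_div, Real.sqrt_div' _ (by positivity), Real.sqrt_sq hT.le]
      field_simp

lemma one_add_mul_exp_neg_le {c z : ℝ} (hc : 0 < c) (hz : 0 ≤ z) :
    (1 + z) * Real.exp (-c * z) ≤ (1 + 2 / c) * Real.exp (-(c / 2 * z)) := by
  have h3 : 1 + c / 2 * z ≤ Real.exp (c / 2 * z) := by
    linarith [Real.add_one_le_exp (c / 2 * z)]
  have h4 : 1 + z ≤ (1 + 2 / c) * Real.exp (c / 2 * z) := by
    have h5 : (1 + 2 / c) * (1 + c / 2 * z) = 1 + z + (2 / c + c / 2 * z) := by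
      field_simp
      ring
    have h6 : 0 ≤ 2 / c + c / 2 * z := by positivity
    have h7 : (1 + 2 / c) * (1 + c / 2 * z) ≤ (1 + 2 / c) * Real.exp (c / 2 * z) := by gcongr
    linarith
  calc (1 + z) * Real.exp (-c * z) ≤
        (1 + 2 / c) * Real.exp (c / 2 * z) * Real.exp (-c * z) := by gcongr
    _ = _ := by
      rw [mul_assoc, ← Real.exp_add]
      congr 2
      ring

lemma abs_exp_neg_sub_exp_neg_le {b y z : ℝ} (hyz : y ≤ z) (hy : b ≤ y) :
    |Real.exp (-y) - Real.exp (-z)| ≤ (z - y) * Real.exp (-b) := by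
  rw [abs_of_nonneg (sub_nonneg.2 (Real.exp_le_exp.2 (by linarith)))]
  have e2 : Real.exp (-z) = Real.exp (-y) * Real.exp (-(z - y)) := by
    rw [← Real.exp_add]; congr 1; ring
  have h3 : 1 - (z - y) ≤ Real.exp (-(z - y)) := by linarith [Real.add_one_le_exp (-(z - y))]
  have h4 : Real.exp (-y) ≤ Real.exp (-b) := Real.exp_le_exp.2 (by linarith)
  calc Real.exp (-y) - Real.exp (-z) = Real.exp (-y) * (1 - Real.exp (-(z - y))) := by
        rw [e2]; ring
    _ ≤ Real.exp (-y) * (z - y) :=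
        mul_le_mul_of_nonneg_left (by linarith) (Real.exp_pos _).le
    _ ≤ Real.exp (-b) * (z - y) := by
      have : 0 ≤ z - y := by linarith
      gcongr
    _ = _ := by ring

/-- Centered Gaussian characteristic functions with nearby variances. -/
lemma abs_exp_neg_mul_sq_sub_le {q : ℝ} (hq : 1 / 2 ≤ q) (t : ℝ) :
    |Real.exp (-(q * t ^ 2 / 2)) - Real.exp (-(t ^ 2 / 2))| ≤
      |q - 1| * |t| * (9 * Real.exp (-(1 / 8 * t ^ 2))) := by
  set x := t ^ 2 with hx
  have hx0 : 0 ≤ x := sq_nonneg t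
  have hlip : |Real.exp (-(q * x / 2)) - Real.exp (-(x / 2))| ≤
      |q - 1| * x / 2 * Real.exp (-(x / 4)) := by
    rcases le_total q 1 with h3 | h3
    · have := abs_exp_neg_sub_exp_neg_le (b := x / 4) (y := q * x / 2) (z := x / 2)
        (by nlinarith) (by nlinarith)
      rw [abs_of_nonpos (by linarith : q - 1 ≤ 0)]
      refine this.trans (le_of_eq (by ring))
    · have := abs_exp_neg_sub_exp_neg_le (b := x / 4) (y := x / 2) (z := q * x / 2)
        (by nlinarith) (by linarith)
      rw [abs_of_nonneg (by linarith : 0 ≤ q - 1), abs_sub_comm]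
      refine this.trans (le_of_eq (by ring))
  have hxt : x = |t| * |t| := by rw [hx, abs_mul_abs_self, sq]
  -- One factor `|t|` of `t ^ 2` must survive for Esseen's inequality; the other is absorbed by half
  -- of the exponent.
  have h6 : |t| / 2 ≤ 9 * Real.exp (x / 8) := by
    have := Real.add_one_le_exp (x / 8)
    nlinarith [sq_nonneg (|t| - 1), abs_nonneg t]
  calc _ ≤ |q - 1| * x / 2 * Real.exp (-(x / 4)) := hlip
    _ = |q - 1| * |t| * (|t| / 2 * Real.exp (-(x / 4))) := by
      nth_rewrite 1 [hxt]; ring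
    _ ≤ |q - 1| * |t| * (9 * Real.exp (x / 8) * Real.exp (-(x / 4))) := by gcongr
    _ = _ := by
      rw [mul_assoc 9, ← Real.exp_add]
      congr 3
      ring

/-- Three errors are added: the approximation of the characteristic function `ζ` at `t / σ`, the
mismatch between `N s` and the true variance `v`, and the phase due to the mean `e`. Each is at most
a constant times `|t| / √N` times a Gaussian factor, and `c₁` is a decay rate that all three share.
-/
lemma norm_standardized_charFun_sub_le {N s v σ e c c₁ C L M R : ℝ} (hN0 : 0 < N) (hσ0 : 0 < σ)
    (hσ2 : σ ^ 2 = v) (hc : 0 < c) (hC : 0 < C) (hL0 : 0 < L) (hM : 0 < M) (hR : 0 ≤ R)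
    (hσinv : 1 / σ ≤ L / Real.sqrt N) (hmean : |e| ≤ C) (hv2 : v ≤ 2 * M * N)
    (hq1 : |N * s / v - 1| ≤ R / Real.sqrt N) (hq2 : 1 / 2 ≤ N * s / v)
    (hc₁ : c₁ = min (c / (2 * M) / 2) (1 / 8)) (t : ℝ) (ζ : ℂ)
    (h1 : ‖ζ - (Real.exp (-(N * ((t / σ) ^ 2 * s / 2))) : ℂ)‖ ≤
      C * (|t / σ| * (1 + N * (t / σ) ^ 2) * Real.exp (-c * (N * (t / σ) ^ 2)))) :
    ‖Complex.exp (((-e / σ : ℝ) : ℂ) * t * Complex.I) * ζ - Complex.exp (-(t : ℂ) ^ 2 / 2)‖ ≤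
      (C * L * (1 + 2 / c) + R * 9 + C * L) / Real.sqrt N *
        (|t| * Real.exp (-c₁ * t ^ 2)) := by
  have hsN0 : 0 < Real.sqrt N := Real.sqrt_pos.2 hN0
  have hv0 : 0 < v := by rw [← hσ2]; positivity
  have hc₁0 : 0 < c₁ := by rw [hc₁]; positivity
  have hc₁1 : c₁ ≤ c / (2 * M) / 2 := by rw [hc₁]; exact min_le_left _ _
  have hc₁2 : c₁ ≤ 1 / 8 := by rw [hc₁]; exact min_le_right _ _
  set x := t ^ 2 with hx
  have hx0 : 0 ≤ x := sq_nonneg t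
  have htσ2 : (t / σ) ^ 2 = x / v := by rw [div_pow, hσ2]
  rw [htσ2] at h1
  set q := N * s / v with hq
  have e1 : N * (x / v * s / 2) = q * x / 2 := by rw [hq]; field_simp
  rw [e1] at h1
  set w := Complex.exp (((-e / σ : ℝ) : ℂ) * t * Complex.I) with hw
  have hw1 : ‖w‖ = 1 := norm_exp_ofReal_mul_ofReal_mul_I _ _
  have hg : Complex.exp (-(t : ℂ) ^ 2 / 2) = (Real.exp (-(x / 2)) : ℂ) := by
    rw [hx]; push_cast; congr 1; ring
  rw [hg]
  have hdec : w * ζ - (Real.exp (-(x / 2)) : ℂ) =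
      w * (ζ - (Real.exp (-(q * x / 2)) : ℂ)) +
      w * ((Real.exp (-(q * x / 2)) - Real.exp (-(x / 2)) : ℝ) : ℂ) +
      (w - 1) * (Real.exp (-(x / 2)) : ℂ) := by push_cast; ring
  rw [hdec]
  have hexp1 : ∀ {y : ℝ}, c₁ * x ≤ y → Real.exp (-y) ≤ Real.exp (-c₁ * x) := fun hy => by
    apply Real.exp_le_exp.2; linarith
  have t3 : ‖(w - 1) * (Real.exp (-(x / 2)) : ℂ)‖ ≤
      C * L / Real.sqrt N * (|t| * Real.exp (-c₁ * x)) := by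
    rw [norm_mul, Complex.norm_real, Real.norm_eq_abs, Real.abs_exp]
    have h2 : ‖w - 1‖ ≤ C * L / Real.sqrt N * |t| := by
      refine (norm_exp_mul_I_sub_one_le _ _).trans ?_
      gcongr
      rw [abs_div, abs_neg, abs_of_pos hσ0]
      calc |e| / σ = |e| * (1 / σ) := by ring
        _ ≤ C * (L / Real.sqrt N) := by gcongr
        _ = _ := by ring
    have h3 : Real.exp (-(x / 2)) ≤ Real.exp (-c₁ * x) := hexp1 (by nlinarith)
    calc _ ≤ C * L / Real.sqrt N * |t| * Real.exp (-c₁ * x) := by gcongr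
      _ = _ := by ring
  have t1 : ‖w * (ζ - (Real.exp (-(q * x / 2)) : ℂ))‖ ≤
      C * L * (1 + 2 / c) / Real.sqrt N * (|t| * Real.exp (-c₁ * x)) := by
    rw [norm_mul, hw1, one_mul]
    refine h1.trans ?_
    set z := N * (x / v) with hz
    have hz0 : 0 ≤ z := by positivity
    have h2 := one_add_mul_exp_neg_le hc hz0
    have h3 : Real.exp (-(c / 2 * z)) ≤ Real.exp (-c₁ * x) := hexp1 (by
      have h5 : x / (2 * M) ≤ z := by
        rw [hz, mul_div_assoc', div_le_div_iff₀ (by positivity) hv0]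
        nlinarith
      calc c₁ * x ≤ c / (2 * M) / 2 * x := by gcongr
        _ = c / 2 * (x / (2 * M)) := by ring
        _ ≤ c / 2 * z := by gcongr)
    have h4 : |t / σ| ≤ L / Real.sqrt N * |t| := by
      rw [abs_div, abs_of_pos hσ0]
      calc |t| / σ = 1 / σ * |t| := by ring
        _ ≤ _ := by gcongr
    calc _ = C * (|t / σ| * ((1 + z) * Real.exp (-c * z))) := by ring
      _ ≤ C * (L / Real.sqrt N * |t| * ((1 + 2 / c) * Real.exp (-c₁ * x))) := by
        have h6 := h2.trans (mul_le_mul_of_nonneg_left h3 (by positivity))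
        gcongr
      _ = _ := by ring
  have t2 : ‖w * ((Real.exp (-(q * x / 2)) - Real.exp (-(x / 2)) : ℝ) : ℂ)‖ ≤
      R * 9 / Real.sqrt N * (|t| * Real.exp (-c₁ * x)) := by
    rw [norm_mul, hw1, one_mul, Complex.norm_real, Real.norm_eq_abs]
    have h7 : Real.exp (-(1 / 8 * x)) ≤ Real.exp (-c₁ * x) :=
      hexp1 (mul_le_mul_of_nonneg_right hc₁2 hx0)
    refine (abs_exp_neg_mul_sq_sub_le hq2 t).trans ?_
    calc _ ≤ R / Real.sqrt N * |t| * (9 * Real.exp (-c₁ * x)) := by gcongr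
      _ = _ := by ring
  refine (norm_add_le _ _).trans ((add_le_add ((norm_add_le _ _).trans (add_le_add t1 t2)) t3).trans
    (le_of_eq ?_))
  ring

/-- Kolmogorov bound for a standardized random variable whose unstandardized characteristic
function, mean and second moment are approximately those of a normal law of variance `N * s`. -/
theorem exists_standardized_bound {s₀ M ε c C : ℝ} (hs₀ : 0 < s₀) (hM : 0 < M) (hε : 0 < ε)
    (hc : 0 < c) (hC : 0 < C) : ∃ D N₀ : ℝ, 0 < D ∧ 1 ≤ N₀ ∧
    ∀ (N s : ℝ) (ρ : Measure ℝ) [IsProbabilityMeasure ρ] (_ : MemLp id 2 ρ), N₀ ≤ N → s₀ ≤ s →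
      s ≤ M → |∫ x, x ∂ρ| ≤ C → |∫ x, x ^ 2 ∂ρ - N * s| ≤ C * Real.sqrt N →
      (∀ t : ℝ, |t| ≤ ε → ‖charFun ρ t - (Real.exp (-(N * (t ^ 2 * s / 2))) : ℂ)‖ ≤
        C * (|t| * (1 + N * t ^ 2) * Real.exp (-c * (N * t ^ 2)))) →
      s₀ / 2 * N ≤ variance id ρ ∧ variance id ρ ≤ 2 * M * N ∧
      kolmogorovDist (ρ.map fun x => 1 / Real.sqrt (variance id ρ) * (x - ∫ x, x ∂ρ))
        (gaussianReal 0 1) ≤ D / Real.sqrt N := by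
  obtain ⟨C₀, hC₀, hK⟩ := exists_kolmogorovDist_gaussian_le
  set C₁ := C + C ^ 2 with hC₁
  have hC₁0 : 0 < C₁ := by positivity
  set c₁ := min (c / (2 * M) / 2) (1 / 8) with hc₁
  have hc₁0 : 0 < c₁ := by positivity
  set L := Real.sqrt (2 / s₀) with hL
  have hL0 : 0 < L := by positivity
  set A := C * L * (1 + 2 / c) + 2 * C₁ / s₀ * 9 + C * L with hA
  have hA0 : 0 < A := by positivity
  -- `D` comes from Esseen's inequality with `T = ε √N / L`. The threshold gives `C₁ √N ≤ (s₀ / 2)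
  -- N`, so the variance stays comparable with `N s`.
  refine ⟨C₀ * (L / ε + A * Real.sqrt (Real.pi / c₁)), 1 + (2 * C₁ / s₀) ^ 2, by positivity,
    by nlinarith [sq_nonneg (2 * C₁ / s₀)], ?_⟩
  intro N s ρ _ hρ hN hs hsM hmean hsec hcf
  have hN1 : 1 ≤ N := by nlinarith [sq_nonneg (2 * C₁ / s₀)]
  have hN0 : 0 < N := by linarith
  have hsN1 : 1 ≤ Real.sqrt N := Real.one_le_sqrt.2 hN1
  have hsN0 : 0 < Real.sqrt N := by linarith
  have hsN : Real.sqrt N ^ 2 = N := Real.sq_sqrt hN0.le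
  have hC₁N : 2 * C₁ / s₀ ≤ Real.sqrt N := Real.le_sqrt_of_sq_le (by linarith)
  have hC₁N' : C₁ * Real.sqrt N ≤ s₀ / 2 * N := by
    rw [div_le_iff₀ hs₀] at hC₁N
    nlinarith
  have hvar : variance id ρ = ∫ x, x ^ 2 ∂ρ - (∫ x, x ∂ρ) ^ 2 := by
    rw [variance_eq_sub hρ]; rfl
  set v := variance id ρ with hv
  set e := ∫ x, x ∂ρ with he
  -- Passing from second moment to variance costs at most `C²`, since the mean is bounded.
  have hvN : |v - N * s| ≤ C₁ * Real.sqrt N := by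
    have h1 : e ^ 2 ≤ C ^ 2 := by rw [← sq_abs]; gcongr
    have h2 : C ^ 2 ≤ C ^ 2 * Real.sqrt N := le_mul_of_one_le_right (by positivity) hsN1
    rw [hvar, hC₁]
    rw [abs_le] at hsec ⊢
    constructor <;> nlinarith [hsec.1, hsec.2, sq_nonneg e]
  have hNs : N * s₀ ≤ N * s := by gcongr
  have hNM : N * s ≤ N * M := by gcongr
  have hs₀M : s₀ ≤ M := hs.trans hsM
  have hv1 : s₀ / 2 * N ≤ v := by linarith [(abs_le.1 hvN).1]
  have hv2 : v ≤ 2 * M * N := by nlinarith [(abs_le.1 hvN).2]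
  have hv3 : v ≤ 2 * (N * s) := by nlinarith [(abs_le.1 hvN).2]
  have hv0 : 0 < v := lt_of_lt_of_le (by positivity) hv1
  refine ⟨hv1, hv2, ?_⟩
  set σ := Real.sqrt v with hσ
  have hσ0 : 0 < σ := Real.sqrt_pos.2 hv0
  have hσ2 : σ ^ 2 = v := Real.sq_sqrt hv0.le
  have hσinv : 1 / σ ≤ L / Real.sqrt N := by
    rw [div_le_div_iff₀ hσ0 hsN0, one_mul, hL, hσ, ← Real.sqrt_mul (by positivity)]
    apply Real.sqrt_le_sqrt
    rw [div_mul_eq_mul_div, le_div_iff₀ hs₀]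
    linarith
  have hLσ : Real.sqrt N / L ≤ σ := by
    rw [div_le_iff₀ hL0]
    rw [div_le_div_iff₀ hσ0 hsN0] at hσinv
    linarith
  have hmeas : Measurable fun x : ℝ => 1 / σ * (x - e) := by fun_prop
  have hpm : IsProbabilityMeasure (ρ.map fun x => 1 / σ * (x - e)) :=
    Measure.isProbabilityMeasure_map hmeas.aemeasurable
  have hρ1 : Integrable id ρ := hρ.integrable (by norm_num)
  have hint : Integrable id (ρ.map fun x => 1 / σ * (x - e)) := by
    rw [integrable_map_measure aestronglyMeasurable_id hmeas.aemeasurable]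
    exact (hρ1.sub (integrable_const e)).const_mul (1 / σ)
  have hψ : ∀ t : ℝ, charFun (ρ.map fun x => 1 / σ * (x - e)) t =
      Complex.exp (((-e / σ : ℝ) : ℂ) * t * Complex.I) * charFun ρ (t / σ) := by
    intro t
    rw [charFun_apply_real, integral_map hmeas.aemeasurable
      (Continuous.aestronglyMeasurable (by fun_prop)), charFun_apply_real, ← integral_const_mul]
    congr 1; ext x
    rw [← Complex.exp_add]
    congr 1
    push_cast
    ring
  have hfin := hK (ρ.map fun x => 1 / σ * (x - e)) hint (ε * (Real.sqrt N / L)) (A / Real.sqrt N) c₁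
    (by positivity) (by positivity) hc₁0 (fun t ht => ?_)
  · refine hfin.trans (le_of_eq ?_)
    field_simp
  have htσ : |t / σ| ≤ ε := by
    rw [abs_div, abs_of_pos hσ0, div_le_iff₀ hσ0]
    exact ht.trans (by gcongr)
  have h1 := hcf (t / σ) htσ
  have hq1 : |N * s / v - 1| ≤ 2 * C₁ / s₀ / Real.sqrt N := by
    have h2 : N * s / v - 1 = -(v - N * s) / v := by field_simp; ring
    rw [h2, abs_div, abs_neg, abs_of_pos hv0, div_le_div_iff₀ hv0 hsN0]
    calc |v - N * s| * Real.sqrt N ≤ C₁ * Real.sqrt N * Real.sqrt N := by gcongr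
      _ = 2 * C₁ / s₀ * (s₀ / 2 * N) := by rw [mul_assoc, Real.mul_self_sqrt hN0.le]; field_simp
      _ ≤ _ := by gcongr
  have hq2 : 1 / 2 ≤ N * s / v := by
    rw [le_div_iff₀ hv0]; linarith
  rw [hψ]
  exact norm_standardized_charFun_sub_le hN0 hσ0 hσ2 hc hC hL0 hM (by positivity) hσinv hmean hv2
    hq1 hq2 hc₁ t _ h1

/-! ### Return to the occupancy statistic -/

namespace Occupancy

/-- If `V = d + U`, then the normalized statistic and its variance are functions of the law
of `U`. -/
lemma sigmaSq_eq_variance_map {n m : ℕ} [NeZero n] {φ : ℕ → ℝ} {U : (Fin m → Fin n) → ℝ} {d : ℝ}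
    (hU : ∀ ω, V m (fun _ => φ) ω = d + U ω) :
    sigmaSq m (fun _ : Fin n => 1 / (n : ℝ)) (fun _ => φ) =
      variance id ((urnLaw m fun _ : Fin n => 1 / (n : ℝ)).map U) := by
  have hVU : V m (fun _ => φ) = fun ω => d + U ω := funext hU
  rw [sigmaSq, hVU, variance_const_add .of_discrete, variance_map aemeasurable_id
    (Measurable.of_discrete).aemeasurable]
  rfl

lemma map_W_eq {n m : ℕ} [NeZero n] {φ : ℕ → ℝ} {U : (Fin m → Fin n) → ℝ} {d : ℝ}
    (hU : ∀ ω, V m (fun _ => φ) ω = d + U ω) :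
    (urnLaw m fun _ : Fin n => 1 / (n : ℝ)).map (W m (fun _ => 1 / (n : ℝ)) fun _ => φ) =
      ((urnLaw m fun _ : Fin n => 1 / (n : ℝ)).map U).map fun x =>
        1 / Real.sqrt (variance id ((urnLaw m fun _ : Fin n => 1 / (n : ℝ)).map U)) *
          (x - ∫ x, x ∂((urnLaw m fun _ : Fin n => 1 / (n : ℝ)).map U)) := by
  have hmU : Measurable U := .of_discrete
  have hint : ∀ f : (Fin m → Fin n) → ℝ,
      Integrable f (urnLaw m fun _ : Fin n => 1 / (n : ℝ)) := fun f => .of_finite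
  rw [Measure.map_map (by fun_prop) hmU]
  congr 1
  ext ω
  rw [W, sigmaSq_eq_variance_map hU, Function.comp_apply,
    integral_map hmU.aemeasurable (Continuous.aestronglyMeasurable (by fun_prop))]
  congr 1
  rw [Finset.sum_sub_distrib]
  simp_rw [mean]
  rw [← integral_finsetSum _ fun i _ => hint _]
  have hV : ∀ ω : Fin m → Fin n, ∑ i, φ (count i ω) = d + U ω := hU
  simp_rw [hV]
  rw [integral_add (integrable_const _) (hint _), integral_const, probReal_univ, one_smul,
    add_sub_add_left_eq_sub]

/-- Order of the variance and Berry–Esseen bound, uniformly over numbers of balls comparable to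
the number of urns. -/
theorem exists_berryEsseen_uniform {φ : ℕ → ℝ} {K : ℝ} (hK : 0 < K)
    (hgrowth : ∀ x : ℕ, |φ x| ≤ K * Real.exp (K * (x : ℝ)))
    (h : ¬ ∃ a b : ℝ, ∀ x : ℕ, φ x = a + b * (x : ℝ)) {l₁ l₂ : ℝ} (hl₁ : 0 < l₁) :
    ∃ a₁ a₂ D N₀ : ℝ, 0 < a₁ ∧ 0 < a₂ ∧ 0 < D ∧ ∀ (n m : ℕ), l₁ * n ≤ m → (m : ℝ) ≤ l₂ * n →
      N₀ ≤ n →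
      a₁ * n ≤ sigmaSq m (fun _ : Fin n => 1 / (n : ℝ)) (fun _ => φ) ∧
      sigmaSq m (fun _ : Fin n => 1 / (n : ℝ)) (fun _ => φ) ≤ a₂ * n ∧
      kolmogorovDist ((urnLaw m fun _ : Fin n => 1 / (n : ℝ)).map
        (W m (fun _ => 1 / (n : ℝ)) fun _ => φ)) (gaussianReal 0 1) ≤ D / Real.sqrt n := by
  obtain ⟨s₀, M, ε, c, C, hs₀, hM, hε, hc, hC, H⟩ :=
    exists_residual_sum_estimates hK hgrowth h (l₂ := l₂) hl₁
  obtain ⟨D, N₀, hD, hN₀, H₂⟩ := exists_standardized_bound hs₀ hM hε hc hC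
  -- The `4` leaves at least half of the urns free when two are fixed for the covariances.
  refine ⟨s₀ / 2, 2 * M, D, max 4 N₀, by positivity, by positivity, hD, ?_⟩
  intro n m h1 h2 hn
  have hn4 : 4 ≤ n := by exact_mod_cast (le_max_left _ _).trans hn
  have : NeZero n := ⟨by omega⟩
  obtain ⟨U, d, s, hU, hs, hsM, hmean, hsec, hcf⟩ := H n m h1 h2 hn4
  rw [map_W_eq hU, sigmaSq_eq_variance_map hU]
  set Q := urnLaw m fun _ : Fin n => 1 / (n : ℝ)
  have hmU : Measurable U := .of_discrete
  have hpm : IsProbabilityMeasure (Q.map U) := Measure.isProbabilityMeasure_map hmU.aemeasurable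
  refine H₂ n s (Q.map U) ?_ ((le_max_right _ _).trans hn) hs hsM ?_ ?_ fun t ht => ?_
  · rw [memLp_map_measure_iff aestronglyMeasurable_id hmU.aemeasurable]
    exact .of_discrete
  · rwa [integral_map hmU.aemeasurable (Continuous.aestronglyMeasurable (by fun_prop))]
  · rwa [integral_map hmU.aemeasurable (Continuous.aestronglyMeasurable (by fun_prop))]
  · rw [charFun_apply_real,
      integral_map hmU.aemeasurable (Continuous.aestronglyMeasurable (by fun_prop))]
    exact hcf t ht

end Occupancy

lemma kolmogorovDist_nonneg (μ ν : Measure ℝ) : 0 ≤ kolmogorovDist μ ν :=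
  Real.iSup_nonneg fun _ => abs_nonneg _

/-- For each `n`, `m n` balls are thrown independently and uniformly into `n` urns. -/
theorem corollary10 (φ : ℕ → ℝ) (K : ℝ) (hK : 0 < K)
    (hgrowth : ∀ x : ℕ, |φ x| ≤ K * Real.exp (K * (x : ℝ)))
    (hnonlinear : ¬ ∃ a b : ℝ, ∀ x : ℕ, φ x = a + b * (x : ℝ))
    (m : ℕ → ℕ) (c : ℝ) (hc : 0 < c)
    (hm : Tendsto (fun n : ℕ => (n : ℝ) / (m n : ℝ)) atTop (nhds c)) :
    ((fun n : ℕ => Occupancy.sigmaSq (n := n) (m n) (fun _ => 1 / (n : ℝ)) (fun _ => φ))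
        =Θ[atTop] (fun n : ℕ => (n : ℝ))) ∧
    ((fun n : ℕ => kolmogorovDist
        ((Occupancy.urnLaw (n := n) (m n) (fun _ => 1 / (n : ℝ))).map
          (Occupancy.W (n := n) (m n) (fun _ => 1 / (n : ℝ)) (fun _ => φ)))
        (gaussianReal 0 1))
        =O[atTop] (fun n : ℕ => (n : ℝ) ^ (-(1 / 2) : ℝ))) := by
  -- Eventually `c / 2 < n / m < 2 c`, which places `m / n` between `1 / (2c)` and `2 / c`.
  obtain ⟨a₁, a₂, D, N₀, ha₁, ha₂, hD, H⟩ := Occupancy.exists_berryEsseen_uniform hK hgrowth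
    hnonlinear (l₁ := 1 / (2 * c)) (l₂ := 2 / c) (by positivity)
  have hev : ∀ᶠ n : ℕ in atTop, 1 / (2 * c) * n ≤ (m n : ℝ) ∧ (m n : ℝ) ≤ 2 / c * n ∧
      N₀ ≤ n := by
    filter_upwards [hm.eventually (lt_mem_nhds (show c / 2 < c by linarith)),
      hm.eventually (gt_mem_nhds (show c < 2 * c by linarith)),
      tendsto_natCast_atTop_atTop.eventually_ge_atTop N₀] with n h1 h2 h3
    -- If `m n = 0` the quotient is `0` by convention, contradicting the lower bound `c / 2`.
    have hmn : (0 : ℝ) < m n := by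
      rcases Nat.eq_zero_or_pos (m n) with h0 | h0
      · rw [h0, Nat.cast_zero, div_zero] at h1
        linarith
      · exact_mod_cast h0
    rw [lt_div_iff₀ hmn] at h1
    rw [div_lt_iff₀ hmn] at h2
    refine ⟨?_, ?_, h3⟩
    · rw [div_mul_eq_mul_div, one_mul, div_le_iff₀ (by positivity)]
      linarith
    · rw [div_mul_eq_mul_div, le_div_iff₀ hc]
      linarith
  refine ⟨⟨?_, ?_⟩, ?_⟩
  · refine IsBigO.of_bound a₂ ?_
    filter_upwards [hev] with n ⟨h1, h2, h3⟩
    obtain ⟨h4, h5, -⟩ := H n (m n) h1 h2 h3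
    rw [Real.norm_eq_abs, Real.norm_eq_abs, Nat.abs_cast,
      abs_of_nonneg (le_trans (by positivity) h4)]
    exact h5
  · refine IsBigO.of_bound a₁⁻¹ ?_
    filter_upwards [hev] with n ⟨h1, h2, h3⟩
    obtain ⟨h4, -, -⟩ := H n (m n) h1 h2 h3
    rw [Real.norm_eq_abs, Real.norm_eq_abs, Nat.abs_cast,
      abs_of_nonneg (le_trans (by positivity) h4), ← div_eq_inv_mul, le_div_iff₀ ha₁]
    linarith
  · refine IsBigO.of_bound D ?_
    filter_upwards [hev] with n ⟨h1, h2, h3⟩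
    obtain ⟨-, -, h6⟩ := H n (m n) h1 h2 h3
    rw [Real.norm_eq_abs, Real.norm_eq_abs, abs_of_nonneg (kolmogorovDist_nonneg _ _),
      abs_of_nonneg (by positivity), Real.rpow_neg (by positivity), ← Real.sqrt_eq_rpow,
      ← div_eq_mul_inv]
    exact h6
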